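/- Let $M$ be a smooth (Hausdorff, finite-dimensional) manifold, let $K:TM\to TM$ be an invertible smooth vector bundle endomorphism over the identity of $M$, and let $L\in\Omega^2(M;TM)$ be a vector-valued $2$-form. Let $\imath_K,\imath_L$ denote the insertion derivations of $\Omega(M)$, of degrees $0$ and $1$: for a $p$-form $\omega$, $p\ge 1$, and vector fields $X_i$, $$\imath_K\omega(X_1,\dots,X_p)=\sum_{i}\omega(X_1,\dots,KX_i,\dots,X_p),$$ $$\imath_L\omega(X_0,\dots,X_p)=\sum_{i<j}(-1)^{i+j-1}\omega(L(X_i,X_j),X_0,\dots,\widehat{X_i},\dots,\widehat{X_j},\dots,X_p),$$ and both vanish on functions. Let $[\ ,\ ]$ be the Lie bracket of vector fields and $\mathrm d$ the exterior derivative. Let $\mathcal L_K=\imath_K\circ \mathrm d-\mathrm d\circ\imath_K$, and let $$T_K(X,Y)=[KX,KY]-K[KX,Y]-K[X,KY]+K^2[X,Y]$$ be the Nijenhuis torsion of $K$. Consider the degree one derivation $D=\mathcal L_K+\imath_L$ of $\Omega(M)$. 1. $D^2=0$ on $\Omega(M)$ if and only if $L(X,Y)=-K^{-1}T_K(X,Y)$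 for all vector fields $X,Y$ on $M$. 2. If $D^2=0$, then there is exactly one Lie algebroid structure $(TM,q,[\![\ ,\ ]\!])$ on the vector bundle $TM$ determined by $D$, i.e. such that $q(X)(f)=Df(X)$ and $$\alpha([\![X,Y]\!])=D(\alpha(Y))(X)-D(\alpha(X))(Y)-D\alpha(X,Y)$$ for all vector fields $X,Y$, all $f\in C^\infty(M)$ and all $\alpha\in\Omega^1(M)$. Its anchor is $q=K$, its bracket is $[\![X,Y]\!]=K^{-1}[KX,KY]$, and it is isomorphic (over the identity of $M$) to the trivial Lie algebroid $(TM,\mathrm{Id},[\ ,\ ])$. -/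

import Mathlib

open scoped Manifold ContDiff

noncomputable section

namespace TangentAlgebroid

section Pointwise

variable {E : Type*} [NormedAddCommGroup E] [NormedSpace ℝ E]

/-- The insertion `i_A η (v₁, …, v_k) = ∑ᵢ η (v₁, …, A vᵢ, …, v_k)` of an endomorphism into an
alternating form (see `insertEnd_apply`); it is zero on forms of degree `0`. -/
def insertEnd (A : E →L[ℝ] E) : (k : ℕ) → (E [⋀^Fin k]→L[ℝ] ℝ) → E [⋀^Fin k]→L[ℝ] ℝ
  | 0, _ => 0
  | _ + 1, η => .alternatizeUncurryFin (η.curryLeft ∘L A)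

/-- The insertion of an alternating bilinear map `B` (a vector-valued two-form) into an
alternating form,
`i_B η (v₀, …, v_k) = ∑_{i < j} (-1) ^ (i + j - 1) η (B (vᵢ, vⱼ), v₀, …, v̂ᵢ, …, v̂ⱼ, …, v_k)`,
that is, the signed sum over shuffles (see `insertBilin_apply`, where the pair `i < j` is encoded
as `(i.castSucc, j.succ)` with `i ≤ j`). It is written here as one half of an alternation, in which
each pair occurs twice. It is zero on forms of degree `0`. -/
def insertBilin (B : E →L[ℝ] E →L[ℝ] E) :
    (k : ℕ) → (E [⋀^Fin k]→L[ℝ] ℝ) → E [⋀^Fin (k + 1)]→L[ℝ] ℝ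
  | 0, _ => 0
  | k + 1, η => (1 / 2 : ℝ) • .alternatizeUncurryFin
      (ContinuousAlternatingMap.alternatizeUncurryFinCLM ℝ E ℝ ∘L
        (ContinuousLinearMap.compL ℝ E E (E [⋀^Fin k]→L[ℝ] ℝ) η.curryLeft ∘L B))

theorem insertEnd_apply (A : E →L[ℝ] E) (k : ℕ) (η : E [⋀^Fin (k + 1)]→L[ℝ] ℝ)
    (v : Fin (k + 1) → E) :
    insertEnd A (k + 1) η v = ∑ i, η (Function.update v i (A (v i))) := by
  simp only [insertEnd, ContinuousAlternatingMap.alternatizeUncurryFin_apply,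
    ContinuousLinearMap.comp_apply, ContinuousAlternatingMap.curryLeft_apply_apply]
  refine Finset.sum_congr rfl fun i _ => ?_
  rw [← Fin.insertNth_removeNth, ContinuousAlternatingMap.map_insertNth]

theorem insertBilin_apply (B : E →L[ℝ] E →L[ℝ] E) (hB : ∀ v, B v v = 0) (k : ℕ)
    (η : E [⋀^Fin (k + 1)]→L[ℝ] ℝ) (v : Fin (k + 2) → E) :
    insertBilin B (k + 1) η v = ∑ i : Fin (k + 1), ∑ j ≥ i, (-1) ^ (i + j : ℕ) *
      η (Matrix.vecCons (B (v i.castSucc) (v j.succ)) (j.removeNth (i.castSucc.removeNth v))) := by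
  have hs : ∀ u w, B w u = - B u w := by
    intro u w
    have := hB (u + w)
    simp only [map_add, _root_.add_apply, hB, zero_add, add_zero] at this
    exact eq_neg_of_add_eq_zero_right (by simpa [add_comm] using this)
  simp only [insertBilin, ContinuousAlternatingMap.smul_apply,
    ContinuousAlternatingMap.alternatizeUncurryFin_alternatizeUncurryFinCLM_comp_apply,
    Finset.smul_sum]
  refine Finset.sum_congr rfl fun i _ => Finset.sum_congr rfl fun j _ => ?_
  rw [show (ContinuousLinearMap.compL ℝ E E (E [⋀^Fin k]→L[ℝ] ℝ) η.curryLeft ∘L B)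
      (v j.succ) (v i.castSucc) = - (ContinuousLinearMap.compL ℝ E E (E [⋀^Fin k]→L[ℝ] ℝ)
        η.curryLeft ∘L B) (v i.castSucc) (v j.succ) by simp [hs (v i.castSucc) (v j.succ)]]
  simp
  ring

theorem contDiff_curryLeft {k : ℕ} :
    ContDiff ℝ ∞ (fun η : E [⋀^Fin (k + 1)]→L[ℝ] ℝ => η.curryLeft) := by
  refine IsBoundedLinearMap.contDiff (𝕜 := ℝ) (E := E [⋀^Fin (k + 1)]→L[ℝ] ℝ)
    (F := E →L[ℝ] E [⋀^Fin k]→L[ℝ] ℝ) ⟨⟨fun _ _ => rfl, fun _ _ => rfl⟩, 1, one_pos, fun η => ?_⟩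
  rw [one_mul, ContinuousAlternatingMap.norm_curryLeft]

theorem contDiff_constOfIsEmpty :
    ContDiff ℝ ∞ (fun c : ℝ => ContinuousAlternatingMap.constOfIsEmpty ℝ E (Fin 0) c) := by
  refine IsBoundedLinearMap.contDiff (𝕜 := ℝ) (F := E [⋀^Fin 0]→L[ℝ] ℝ)
    ⟨⟨fun _ _ => rfl, fun _ _ => rfl⟩, 1, one_pos, fun c => ?_⟩
  rw [one_mul]
  exact (ContinuousAlternatingMap.norm_constOfIsEmpty ℝ E (ι := Fin 0) c).le

theorem contDiffOn_compL {G : Type*} [NormedAddCommGroup G] [NormedSpace ℝ G]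
    {c : E → E →L[ℝ] G} {s : Set E} (hc : ContDiffOn ℝ ∞ c s) :
    ContDiffOn ℝ ∞ (fun y => ContinuousLinearMap.compL ℝ E E G (c y)) s := by
  have h : ContDiff ℝ ∞ (fun g : E →L[ℝ] G => ContinuousLinearMap.compL ℝ E E G g) := by
    fun_prop
  exact h.comp_contDiffOn hc

theorem contDiffOn_const_comp {G H : Type*} [NormedAddCommGroup G] [NormedSpace ℝ G]
    [NormedAddCommGroup H] [NormedSpace ℝ H] (T : G →L[ℝ] H)
    {c : E → E →L[ℝ] G} {s : Set E} (hc : ContDiffOn ℝ ∞ c s) :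
    ContDiffOn ℝ ∞ (fun y => T ∘L c y) s :=
  (contDiffOn_const (c := T)).clm_comp hc

theorem contDiffOn_insertEnd {A : E → E →L[ℝ] E} {k : ℕ} {η : E → E [⋀^Fin k]→L[ℝ] ℝ} {s : Set E}
    (hA : ContDiffOn ℝ ∞ A s) (hη : ContDiffOn ℝ ∞ η s) :
    ContDiffOn ℝ ∞ (fun y => insertEnd (A y) k (η y)) s := by
  cases k with
  | zero => exact contDiffOn_const
  | succ k =>
    have h1 : ContDiffOn ℝ ∞ (fun y => (η y).curryLeft) s :=
      contDiff_curryLeft.comp_contDiffOn hη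
    exact (ContinuousAlternatingMap.alternatizeUncurryFinCLM ℝ E ℝ).contDiff.comp_contDiffOn
      (h1.clm_comp hA)

theorem contDiffOn_insertBilin {B : E → E →L[ℝ] E →L[ℝ] E} {k : ℕ}
    {η : E → E [⋀^Fin k]→L[ℝ] ℝ} {s : Set E}
    (hB : ContDiffOn ℝ ∞ B s) (hη : ContDiffOn ℝ ∞ η s) :
    ContDiffOn ℝ ∞ (fun y => insertBilin (B y) k (η y)) s := by
  cases k with
  | zero => exact contDiffOn_const
  | succ k =>
    have h1 : ContDiffOn ℝ ∞ (fun y => (η y).curryLeft) s :=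
      contDiff_curryLeft.comp_contDiffOn hη
    have h2 := contDiffOn_compL h1
    have h3 := contDiffOn_const_comp
      (ContinuousAlternatingMap.alternatizeUncurryFinCLM ℝ E ℝ (n := k)) (h2.clm_comp hB)
    have h4 := (ContinuousAlternatingMap.alternatizeUncurryFinCLM ℝ E ℝ).contDiff.comp_contDiffOn h3
    exact h4.const_smul (1 / 2 : ℝ)

theorem insertEnd_comp (A P Q : E →L[ℝ] E) (hPQ : P ∘L Q = .id ℝ E) (k : ℕ)
    (η : E [⋀^Fin k]→L[ℝ] ℝ) :
    (insertEnd A k η).compContinuousLinearMap P =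
      insertEnd (Q ∘L A ∘L P) k (η.compContinuousLinearMap P) := by
  have h : ∀ u, P (Q u) = u := fun u => by simpa using congrArg (fun f => f u) hPQ
  cases k with
  | zero => ext; simp [insertEnd]
  | succ k =>
    ext v
    simp only [insertEnd_apply, ContinuousAlternatingMap.compContinuousLinearMap_apply]
    refine Finset.sum_congr rfl fun i _ => congrArg η ?_
    ext j
    by_cases hj : j = i
    · subst hj; simp [h]
    · simp [hj]

theorem curryLeft_comp {k : ℕ} (η : E [⋀^Fin (k + 1)]→L[ℝ] ℝ) (P Q : E →L[ℝ] E)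
    (hPQ : P ∘L Q = .id ℝ E) (u : E) :
    (η.curryLeft u).compContinuousLinearMap P = (η.compContinuousLinearMap P).curryLeft (Q u) := by
  have h : P (Q u) = u := by simpa using congrArg (fun f => f u) hPQ
  ext v
  simp only [ContinuousAlternatingMap.compContinuousLinearMap_apply,
    ContinuousAlternatingMap.curryLeft_apply_apply]
  congr 1
  ext l
  refine Fin.cases ?_ (fun l => ?_) l <;> simp [h]

theorem insertBilin_comp (B : E →L[ℝ] E →L[ℝ] E) (P : E →L[ℝ] E)
    (B' : E →L[ℝ] E →L[ℝ] E) (hB' : ∀ u w, P (B' u w) = B (P u) (P w)) (k : ℕ)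
    (η : E [⋀^Fin k]→L[ℝ] ℝ) :
    (insertBilin B k η).compContinuousLinearMap P =
      insertBilin B' k (η.compContinuousLinearMap P) := by
  cases k with
  | zero => ext; simp [insertBilin]
  | succ k =>
    ext v
    simp only [insertBilin, ContinuousAlternatingMap.compContinuousLinearMap_apply,
      ContinuousAlternatingMap.smul_apply,
      ContinuousAlternatingMap.alternatizeUncurryFin_alternatizeUncurryFinCLM_comp_apply]
    congr 1
    refine Finset.sum_congr rfl fun i _ => Finset.sum_congr rfl fun j _ => ?_
    simp [hB']
    rfl

end Pointwise

section Manifold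

variable (E : Type*) [NormedAddCommGroup E] [NormedSpace ℝ E]
  (M : Type*) [TopologicalSpace M] [ChartedSpace E M] [IsManifold 𝓘(ℝ, E) ∞ M]

/-- Smooth vector fields on `M`. -/
abbrev VField : Type _ := Cₛ^∞⟮𝓘(ℝ, E); E, (TangentSpace 𝓘(ℝ, E) : M → Type _)⟯

/-- Smooth endomorphisms of the vector bundle `TM`, i.e. smooth sections of `Hom (TM, TM)`;
equivalently, vector-valued one-forms. -/
abbrev EndTM : Type _ :=
  Cₛ^∞⟮𝓘(ℝ, E); E →L[ℝ] E,
    fun x : M => TangentSpace 𝓘(ℝ, E) x →L[ℝ] TangentSpace 𝓘(ℝ, E) x⟯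

/-- Vector-valued two-forms: smooth sections of the bundle of bilinear maps `TM × TM → TM` that
are alternating. -/
structure VectorTwoForm where
  toSection : Cₛ^∞⟮𝓘(ℝ, E); E →L[ℝ] E →L[ℝ] E, fun x : M =>
    TangentSpace 𝓘(ℝ, E) x →L[ℝ] TangentSpace 𝓘(ℝ, E) x →L[ℝ] TangentSpace 𝓘(ℝ, E) x⟯
  map_self : ∀ (x : M) (v : TangentSpace 𝓘(ℝ, E) x), toSection x v v = 0

variable {E M}

/-- The expression of a (not necessarily smooth) differential form in the chart at `x₀`, that is,
its pullback under the inverse of the chart. -/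
def inChart {k : ℕ} (α : ∀ x : M, TangentSpace 𝓘(ℝ, E) x [⋀^Fin k]→L[ℝ] ℝ) (x₀ : M) (y : E) :
    E [⋀^Fin k]→L[ℝ] ℝ :=
  (α ((extChartAt 𝓘(ℝ, E) x₀).symm y)).compContinuousLinearMap
    (mfderiv 𝓘(ℝ, E) 𝓘(ℝ, E) (extChartAt 𝓘(ℝ, E) x₀).symm y)

variable (E M) in
/-- The space `Ω^k(M)` of smooth differential `k`-forms: families of alternating `k`-linear forms on
the tangent spaces whose expressions in the charts are smooth. -/
def DiffForm (k : ℕ) : Submodule ℝ (∀ x : M, TangentSpace 𝓘(ℝ, E) x [⋀^Fin k]→L[ℝ] ℝ) where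
  carrier := {α | ∀ x₀ : M, ContDiffOn ℝ ∞ (inChart α x₀) (extChartAt 𝓘(ℝ, E) x₀).target}
  add_mem' hα hβ x₀ := (hα x₀).add (hβ x₀)
  zero_mem' _ := (contDiffOn_const (c := (0 : E [⋀^Fin k]→L[ℝ] ℝ))).congr fun _ _ => rfl
  smul_mem' c _ hα x₀ := (hα x₀).const_smul c

/-- The derivative of the chart at `x₀`, at the point `x`. -/
def chartDAt (x₀ x : M) : E →L[ℝ] E :=
  mfderiv 𝓘(ℝ, E) 𝓘(ℝ, E) (extChartAt 𝓘(ℝ, E) x₀) x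

/-- The derivative of the chart at `x₀`, at the point with coordinates `y`. -/
def chartD (x₀ : M) (y : E) : E →L[ℝ] E :=
  mfderiv 𝓘(ℝ, E) 𝓘(ℝ, E) (extChartAt 𝓘(ℝ, E) x₀) ((extChartAt 𝓘(ℝ, E) x₀).symm y)

/-- The derivative of the inverse of the chart at `x₀`, at the point with coordinates `y`. -/
def chartDInv (x₀ : M) (y : E) : E →L[ℝ] E :=
  mfderiv 𝓘(ℝ, E) 𝓘(ℝ, E) (extChartAt 𝓘(ℝ, E) x₀).symm y

theorem chartDInv_comp (x₀ : M) {y : E} (hy : y ∈ (extChartAt 𝓘(ℝ, E) x₀).target) :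
    chartDInv x₀ y ∘L chartD x₀ y = .id ℝ E := by
  have : IsManifold 𝓘(ℝ, E) 1 M := .of_le (n := ∞) (by simp)
  have h := mfderivWithin_extChartAt_symm_comp_mfderiv_extChartAt (I := 𝓘(ℝ, E)) (x := x₀) hy
  rw [ModelWithCorners.range_eq_univ, mfderivWithin_univ] at h
  exact h

theorem chartD_comp (x₀ : M) {y : E} (hy : y ∈ (extChartAt 𝓘(ℝ, E) x₀).target) :
    chartD x₀ y ∘L chartDInv x₀ y = .id ℝ E := by
  have : IsManifold 𝓘(ℝ, E) 1 M := .of_le (n := ∞) (by simp)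
  have h := mfderiv_extChartAt_comp_mfderivWithin_extChartAt_symm (I := 𝓘(ℝ, E)) (x := x₀) hy
  rw [ModelWithCorners.range_eq_univ, mfderivWithin_univ] at h
  exact h


theorem contMDiffOn_chartDInv (x₀ : M) (u : E) :
    ContMDiffOn 𝓘(ℝ, E) (𝓘(ℝ, E).prod 𝓘(ℝ, E)) ∞
      (fun x : M => Bundle.TotalSpace.mk' E (E := (TangentSpace 𝓘(ℝ, E) : M → Type _)) x
        (show TangentSpace 𝓘(ℝ, E) x from chartDInv x₀ (extChartAt 𝓘(ℝ, E) x₀ x) u))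
      (chartAt E x₀).source := by
  have : IsManifold 𝓘(ℝ, E) 1 M := .of_le (n := ∞) (by simp)
  let e := trivializationAt E (TangentSpace 𝓘(ℝ, E)) x₀
  have h1 : ContMDiffOn 𝓘(ℝ, E) (𝓘(ℝ, E).prod 𝓘(ℝ, E)) ∞
      (fun x : M => Bundle.TotalSpace.mk' E (E := (TangentSpace 𝓘(ℝ, E) : M → Type _)) x
        (e.symmL ℝ x u)) e.baseSet := by
    rw [e.contMDiffOn_section_baseSet_iff]
    refine (contMDiffOn_const (c := u)).congr fun x hx => ?_
    simp [e.symmL_apply hx, e.mk_symm hx, e.apply_symm_apply' hx]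
  refine h1.congr fun x hx => ?_
  have h := TangentBundle.symmL_trivializationAt (I := 𝓘(ℝ, E)) (x₀ := x₀) (x := x) hx
  rw [ModelWithCorners.range_eq_univ, mfderivWithin_univ] at h
  exact congrArg (fun f : E →L[ℝ] E => Bundle.TotalSpace.mk' E
    (E := (TangentSpace 𝓘(ℝ, E) : M → Type _)) x (f u)) h.symm

theorem contDiffOn_chartD {X : ∀ x : M, TangentSpace 𝓘(ℝ, E) x} (x₀ : M)
    (hX : ContMDiffOn 𝓘(ℝ, E) (𝓘(ℝ, E).prod 𝓘(ℝ, E)) ∞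
      (fun x : M => Bundle.TotalSpace.mk' E (E := (TangentSpace 𝓘(ℝ, E) : M → Type _)) x (X x))
      (chartAt E x₀).source) :
    ContDiffOn ℝ ∞ (fun y => chartD x₀ y (X ((extChartAt 𝓘(ℝ, E) x₀).symm y)))
      (extChartAt 𝓘(ℝ, E) x₀).target := by
  have : IsManifold 𝓘(ℝ, E) 1 M := .of_le (n := ∞) (by simp)
  let e := trivializationAt E (TangentSpace 𝓘(ℝ, E)) x₀
  have hX' := (e.contMDiffOn_section_baseSet_iff (IB := 𝓘(ℝ, E)) (n := ∞) (s := X)).1 hX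
  rw [← contMDiffOn_iff_contDiffOn]
  have hm : ∀ y ∈ (extChartAt 𝓘(ℝ, E) x₀).target,
      (extChartAt 𝓘(ℝ, E) x₀).symm y ∈ e.baseSet := fun y hy => by
    have := (extChartAt 𝓘(ℝ, E) x₀).map_target hy
    rwa [extChartAt_source] at this
  refine (hX'.comp (contMDiffOn_extChartAt_symm x₀) hm).congr fun y hy => ?_
  have h := TangentBundle.continuousLinearMapAt_trivializationAt (I := 𝓘(ℝ, E)) (x₀ := x₀)
    (hm y hy)
  refine (congrArg (fun f : E →L[ℝ] E => f (X ((extChartAt 𝓘(ℝ, E) x₀).symm y))) h.symm).trans ?_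
  exact congrFun (e.coe_linearMapAt_of_mem (R := ℝ) (hm y hy)) _


/-- The exterior derivative of a smooth form, computed at `x` in the chart at `x`. -/
def rawExtD {k : ℕ} (α : DiffForm E M k) (x : M) :
    TangentSpace 𝓘(ℝ, E) x [⋀^Fin (k + 1)]→L[ℝ] ℝ :=
  (extDeriv (inChart α.1 x) (extChartAt 𝓘(ℝ, E) x x)).compContinuousLinearMap
    (mfderiv 𝓘(ℝ, E) 𝓘(ℝ, E) (extChartAt 𝓘(ℝ, E) x) x)

/-- The exterior derivative may be computed in any chart. -/
theorem inChart_rawExtD {k : ℕ} (α : DiffForm E M k) (x₀ : M) {y : E}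
    (hy : y ∈ (extChartAt 𝓘(ℝ, E) x₀).target) :
    inChart (rawExtD α) x₀ y = extDeriv (inChart α.1 x₀) y := by
  have : IsManifold 𝓘(ℝ, E) 1 M := .of_le (n := ∞) (by simp)
  set φ₀ := extChartAt 𝓘(ℝ, E) x₀ with hφ₀
  set x : M := φ₀.symm y with hx
  set φ := extChartAt 𝓘(ℝ, E) x with hφ
  let a : M → E [⋀^Fin k]→L[ℝ] ℝ := α.1
  let f : E → E := fun z => φ (φ₀.symm z)
  have hsymm : ContMDiffOn 𝓘(ℝ, E) 𝓘(ℝ, E) ∞ φ₀.symm φ₀.target := contMDiffOn_extChartAt_symm x₀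
  have ht : φ₀.target ∈ nhds y := (isOpen_extChartAt_target x₀).mem_nhds hy
  have hxs : x ∈ φ.source := mem_extChartAt_source x
  have hs : φ₀.target ∩ φ₀.symm ⁻¹' φ.source ∈ nhds y :=
    Filter.inter_mem ht ((hsymm.contMDiffAt ht).continuousAt.preimage_mem_nhds
      ((isOpen_extChartAt_source x).mem_nhds hxs))
  have hfd : ∀ z ∈ φ₀.target ∩ φ₀.symm ⁻¹' φ.source, fderiv ℝ f z =
      chartDAt x (φ₀.symm z) ∘L chartDInv x₀ z := by
    intro z hz
    have h1 : MDifferentiableAt 𝓘(ℝ, E) 𝓘(ℝ, E) φ₀.symm z :=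
      (hsymm.contMDiffAt ((isOpen_extChartAt_target x₀).mem_nhds hz.1)).mdifferentiableAt (by simp)
    have h2 : MDifferentiableAt 𝓘(ℝ, E) 𝓘(ℝ, E) φ (φ₀.symm z) :=
      mdifferentiableAt_extChartAt (by have := hz.2; rwa [Set.mem_preimage, extChartAt_source] at this)
    have h3 := mfderiv_comp z h2 h1
    rw [mfderiv_eq_fderiv] at h3
    exact h3
  have hf : ContDiffAt ℝ ∞ f y := by
    rw [← contMDiffAt_iff_contDiffAt]
    exact ContMDiffAt.comp y (contMDiffAt_extChartAt (I := 𝓘(ℝ, E)) (n := ∞) (x := x))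
      (hsymm.contMDiffAt ht)
  have hform : ∀ z ∈ φ₀.target ∩ φ₀.symm ⁻¹' φ.source,
      inChart α.1 x₀ z = (inChart α.1 x (f z)).compContinuousLinearMap (fderiv ℝ f z) := by
    intro z hz
    have e1 : φ.symm (f z) = φ₀.symm z := φ.left_inv hz.2
    have e2 : chartDInv x (f z) ∘L chartDAt x (φ₀.symm z) =
        .id ℝ E := by
      have h := mfderivWithin_extChartAt_symm_comp_mfderiv_extChartAt' (I := 𝓘(ℝ, E)) (x := x) hz.2
      rw [ModelWithCorners.range_eq_univ, mfderivWithin_univ] at h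
      exact h
    have e3 : chartDInv x (f z) ∘L fderiv ℝ f z = chartDInv x₀ z := by
      rw [hfd z hz, ← ContinuousLinearMap.comp_assoc, e2, ContinuousLinearMap.id_comp]
    calc inChart α.1 x₀ z = (a (φ₀.symm z)).compContinuousLinearMap (chartDInv x₀ z) := rfl
      _ = (a (φ.symm (f z))).compContinuousLinearMap (chartDInv x (f z) ∘L fderiv ℝ f z) := by
        rw [e1, e3]
      _ = _ := rfl
  have hev : inChart α.1 x₀ =ᶠ[nhds y]
      fun z => (inChart α.1 x (f z)).compContinuousLinearMap (fderiv ℝ f z) :=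
    Filter.eventually_of_mem hs hform
  have hd : DifferentiableAt ℝ (inChart α.1 x) (f y) :=
    ((α.2 x).contDiffAt ((isOpen_extChartAt_target x).mem_nhds
      (mem_extChartAt_target x))).differentiableAt (by simp)
  rw [hev.extDeriv_eq, extDeriv_pullback hd hf (by simpa using (ENat.LEInfty.out : (2 : ℕ∞ω) ≤ ∞)), hfd y (mem_of_mem_nhds hs)]
  rfl

/-- The exterior derivative `d : Ω^k(M) → Ω^{k+1}(M)`. -/
def extD {k : ℕ} (α : DiffForm E M k) : DiffForm E M (k + 1) :=
  ⟨rawExtD α, fun x₀ => by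
    refine ContDiffOn.congr ?_ fun y hy => inChart_rawExtD α x₀ hy
    have h := (α.2 x₀).fderiv_of_isOpen (m := ∞) (isOpen_extChartAt_target x₀) (by simp)
    exact (ContinuousAlternatingMap.alternatizeUncurryFinCLM ℝ E ℝ).contDiff.comp_contDiffOn h⟩

theorem mdifferentiableAt_field (X : VField E M) (x : M) :
    MDifferentiableAt 𝓘(ℝ, E) (𝓘(ℝ, E).prod 𝓘(ℝ, E))
      (fun x : M => Bundle.TotalSpace.mk' E (E := (TangentSpace 𝓘(ℝ, E) : M → Type _)) x (X x)) x :=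
  X.contMDiff.contMDiffAt.mdifferentiableAt (by simp)

variable (E M) in
theorem isManifold_two : IsManifold 𝓘(ℝ, E) (minSmoothness ℝ 2) M :=
  .of_le (n := ∞) (by simpa using (ENat.LEInfty.out : (2 : ℕ∞ω) ≤ ∞))

variable [FiniteDimensional ℝ E]

/-- The expression of an endomorphism of `TM` in the chart at `x₀`. -/
def endInChart (K : EndTM E M) (x₀ : M) (y : E) : E →L[ℝ] E :=
  chartD x₀ y ∘L (show E →L[ℝ] E from K ((extChartAt 𝓘(ℝ, E) x₀).symm y)) ∘L chartDInv x₀ y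

theorem contDiffOn_endInChart (K : EndTM E M) (x₀ : M) :
    ContDiffOn ℝ ∞ (endInChart K x₀) (extChartAt 𝓘(ℝ, E) x₀).target := by
  rw [contDiffOn_clm_apply]
  intro u
  have h := contDiffOn_chartD x₀ (K.contMDiff.contMDiffOn.clm_bundle_apply
    (contMDiffOn_chartDInv x₀ u))
  refine h.congr fun y hy => ?_
  rw [(extChartAt 𝓘(ℝ, E) x₀).right_inv hy]
  rfl

/-- The expression of a vector-valued two-form in the chart at `x₀`. -/
def bilinInChart (L : VectorTwoForm E M) (x₀ : M) (y : E) : E →L[ℝ] E →L[ℝ] E :=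
  ContinuousLinearMap.bilinearComp
    (ContinuousLinearMap.compL ℝ E E E (chartD x₀ y) ∘L
      (show E →L[ℝ] E →L[ℝ] E from L.toSection ((extChartAt 𝓘(ℝ, E) x₀).symm y)))
    (chartDInv x₀ y) (chartDInv x₀ y)

theorem contDiffOn_bilinInChart (L : VectorTwoForm E M) (x₀ : M) :
    ContDiffOn ℝ ∞ (bilinInChart L x₀) (extChartAt 𝓘(ℝ, E) x₀).target := by
  rw [contDiffOn_clm_apply]
  intro u
  rw [contDiffOn_clm_apply]
  intro w
  have h := contDiffOn_chartD x₀ (L.toSection.contMDiff.contMDiffOn.clm_bundle_apply₂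
    (contMDiffOn_chartDInv x₀ u) (contMDiffOn_chartDInv x₀ w))
  refine h.congr fun y hy => ?_
  rw [(extChartAt 𝓘(ℝ, E) x₀).right_inv hy]
  rfl

/-- The insertion `i_K : Ω^k(M) → Ω^k(M)` of an endomorphism `K` of `TM`. -/
def iotaEnd (K : EndTM E M) {k : ℕ} (α : DiffForm E M k) : DiffForm E M k :=
  ⟨fun x => insertEnd (E := E) (K x) k (α.1 x), fun x₀ => by
    refine (contDiffOn_insertEnd (contDiffOn_endInChart K x₀) (α.2 x₀)).congr fun y hy => ?_
    exact insertEnd_comp (E := E) _ (chartDInv x₀ y) (chartD x₀ y) (chartDInv_comp x₀ hy) k _⟩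

/-- The insertion `i_L : Ω^k(M) → Ω^{k+1}(M)` of a vector-valued two-form `L`. -/
def iotaTwo (L : VectorTwoForm E M) {k : ℕ} (α : DiffForm E M k) : DiffForm E M (k + 1) :=
  ⟨fun x => insertBilin (E := E) (L.toSection x) k (α.1 x), fun x₀ => by
    refine (contDiffOn_insertBilin (contDiffOn_bilinInChart L x₀) (α.2 x₀)).congr fun y hy => ?_
    refine insertBilin_comp (E := E) _ (chartDInv x₀ y) _ (fun u w => ?_) k _
    exact congrArg (fun f : E →L[ℝ] E => f _) (chartDInv_comp x₀ hy)⟩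

/-- The contraction `α ↦ α (X, ·, …, ·)` of a form with a vector field. -/
def interior (X : VField E M) {k : ℕ} (α : DiffForm E M (k + 1)) : DiffForm E M k :=
  ⟨fun x => ContinuousAlternatingMap.curryLeft (E := E) (α.1 x) (X x), fun x₀ => by
    refine ((contDiff_curryLeft.comp_contDiffOn (α.2 x₀)).clm_apply
      (contDiffOn_chartD x₀ X.contMDiff.contMDiffOn)).congr fun y hy => ?_
    exact curryLeft_comp (E := E) _ (chartDInv x₀ y) (chartD x₀ y) (chartDInv_comp x₀ hy) _⟩

/-- A smooth function, regarded as a differential form of degree `0`. -/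
def ofFun (f : C^∞⟮𝓘(ℝ, E), M; ℝ⟯) : DiffForm E M 0 :=
  ⟨fun x => ContinuousAlternatingMap.constOfIsEmpty ℝ (TangentSpace 𝓘(ℝ, E) x) (Fin 0) (f x),
    fun x₀ => by
    have h1 : ContDiffOn ℝ ∞ (fun y => f ((extChartAt 𝓘(ℝ, E) x₀).symm y))
        (extChartAt 𝓘(ℝ, E) x₀).target :=
      contMDiffOn_iff_contDiffOn.1 (f.contMDiff.comp_contMDiffOn (contMDiffOn_extChartAt_symm x₀))
    refine (contDiff_constOfIsEmpty.comp_contDiffOn h1).congr fun y _ => ?_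
    rfl⟩

/-- The Lie derivative `𝓛_K = [i_K, d] = i_K ∘ d - d ∘ i_K` along the vector-valued one-form `K`. -/
def lieDer (K : EndTM E M) {k : ℕ} (α : DiffForm E M k) : DiffForm E M (k + 1) :=
  iotaEnd K (extD α) - extD (iotaEnd K α)

/-- The degree one derivation `D = 𝓛_K + i_L` of `Ω(M)`, on forms of degree `k`. -/
def fnDer (K : EndTM E M) (L : VectorTwoForm E M) {k : ℕ} (α : DiffForm E M k) :
    DiffForm E M (k + 1) :=
  lieDer K α + iotaTwo L α

/-- The vector field `K X`. -/
def applyEnd (K : EndTM E M) (X : VField E M) : VField E M :=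
  ⟨fun x => K x (X x), K.contMDiff.clm_bundle_apply X.contMDiff⟩

/-- The vector field `f X`. -/
def mulField (f : C^∞⟮𝓘(ℝ, E), M; ℝ⟯) (X : VField E M) : VField E M :=
  ⟨fun x => f x • X x, f.contMDiff.smul_section X.contMDiff⟩

/-- The derivative `X f` at the point `x`. -/
def dirDeriv (X : VField E M) (f : C^∞⟮𝓘(ℝ, E), M; ℝ⟯) (x : M) : ℝ :=
  mfderiv 𝓘(ℝ, E) 𝓘(ℝ, ℝ) f x (X x)

/-- The Lie bracket `[X, Y]` of vector fields. -/
def lieBracket (X Y : VField E M) : VField E M :=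
  ⟨VectorField.mlieBracket 𝓘(ℝ, E) X Y, by
    have : CompleteSpace E := FiniteDimensional.complete ℝ E
    have := isManifold_two E M
    have : IsManifold 𝓘(ℝ, E) ((⊤ : ℕ∞) + 1) M := inferInstanceAs (IsManifold 𝓘(ℝ, E) ∞ M)
    exact fun x => ContMDiffAt.mlieBracket_vectorField (n := ⊤) (m := ⊤) (X.contMDiff x)
      (Y.contMDiff x) (by simp)⟩

/-- The Nijenhuis torsion
`T_K (X, Y) = [K X, K Y] - K [K X, Y] - K [X, K Y] + K² [X, Y]`. -/
def torsion (K : EndTM E M) (X Y : VField E M) : VField E M :=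
  lieBracket (applyEnd K X) (applyEnd K Y) - applyEnd K (lieBracket (applyEnd K X) Y)
    - applyEnd K (lieBracket X (applyEnd K Y)) + applyEnd K (applyEnd K (lieBracket X Y))

variable (E M) in
/-- A Lie algebroid structure on the vector bundle `TM`: a vector bundle map `TM → TM` over `M`
(the anchor) and a Lie bracket on the space of sections of `TM` satisfying the Leibniz rule. -/
@[ext]
structure LieAlgebroidTM where
  anchor : EndTM E M
  bracket : VField E M →ₗ[ℝ] VField E M →ₗ[ℝ] VField E M
  bracket_self : ∀ X, bracket X X = 0
  jacobi : ∀ X Y Z, bracket X (bracket Y Z) = bracket (bracket X Y) Z + bracket Y (bracket X Z)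
  leibniz : ∀ X Y (f : C^∞⟮𝓘(ℝ, E), M; ℝ⟯) (x : M),
    bracket X (mulField f Y) x = f x • bracket X Y x + dirDeriv (applyEnd anchor X) f x • Y x

variable (E M) in
/-- The identity endomorphism of `TM`. -/
def idTM : EndTM E M :=
  ⟨fun x => ContinuousLinearMap.id ℝ (TangentSpace 𝓘(ℝ, E) x), fun x₀ => by
    rw [contMDiffAt_hom_bundle]
    refine ⟨contMDiffAt_id, ?_⟩
    refine (contMDiffAt_const (c := ContinuousLinearMap.id ℝ E)).congr_of_eventuallyEq ?_
    filter_upwards [(chartAt E x₀).open_source.mem_nhds (mem_chart_source E x₀)] with x hx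
    rw [ContinuousLinearMap.inCoordinates_eq hx hx]
    ext v
    simp⟩

variable (E M) in
/-- The Lie bracket of vector fields as a bilinear map. -/
def lieBracketBilin : VField E M →ₗ[ℝ] VField E M →ₗ[ℝ] VField E M :=
  LinearMap.mk₂ ℝ lieBracket
    (fun X X' Y => by
      have := isManifold_two E M
      have : CompleteSpace E := FiniteDimensional.complete ℝ E
      ext x
      exact VectorField.mlieBracket_add_left (mdifferentiableAt_field X x)
        (mdifferentiableAt_field X' x))
    (fun c X Y => by
      have := isManifold_two E M
      have : CompleteSpace E := FiniteDimensional.complete ℝ E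
      ext x
      exact VectorField.mlieBracket_const_smul_left (mdifferentiableAt_field X x))
    (fun X Y Y' => by
      have := isManifold_two E M
      have : CompleteSpace E := FiniteDimensional.complete ℝ E
      ext x
      exact VectorField.mlieBracket_add_right (mdifferentiableAt_field Y x)
        (mdifferentiableAt_field Y' x))
    (fun c X Y => by
      have := isManifold_two E M
      have : CompleteSpace E := FiniteDimensional.complete ℝ E
      ext x
      exact VectorField.mlieBracket_const_smul_right (mdifferentiableAt_field Y x))

variable (E M) in
/-- The trivial Lie algebroid `(TM, Id, [ , ])`. -/
def trivialAlgebroid : LieAlgebroidTM E M where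
  anchor := idTM E M
  bracket := lieBracketBilin E M
  bracket_self X := by
    ext x
    exact congrFun (VectorField.mlieBracket_self (I := 𝓘(ℝ, E)) (V := ⇑X)) x
  jacobi X Y Z := by
    have : IsManifold 𝓘(ℝ, E) (minSmoothness ℝ 3) M := .of_le (n := ∞) (by
      simpa using (ENat.LEInfty.out : (3 : ℕ∞ω) ≤ ∞))
    have : CompleteSpace E := FiniteDimensional.complete ℝ E
    have h2 : minSmoothness ℝ 2 ≤ ∞ := by simpa using (ENat.LEInfty.out : (2 : ℕ∞ω) ≤ ∞)
    ext x
    exact VectorField.leibniz_identity_mlieBracket_apply (X.contMDiff.contMDiffAt.of_le h2)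
      (Y.contMDiff.contMDiffAt.of_le h2) (Z.contMDiff.contMDiffAt.of_le h2)
  leibniz X Y f x := by
    have := isManifold_two E M
    have : CompleteSpace E := FiniteDimensional.complete ℝ E
    have h := VectorField.mlieBracket_smul_right (I := 𝓘(ℝ, E)) (V := ⇑X) (W := ⇑Y)
      (f.contMDiff.contMDiffAt.mdifferentiableAt (by simp) : MDifferentiableAt _ _ f x)
      (mdifferentiableAt_field Y x)
    exact h.trans (add_comm _ _)

/-- An isomorphism of Lie algebroid structures on `TM` (over the identity of `M`): an isomorphism of
the vector bundle `TM` that is compatible with the anchors and the brackets. The inverse of a smooth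
fibrewise invertible bundle map is again smooth. -/
structure LieAlgebroidTM.Iso (𝓐 𝓑 : LieAlgebroidTM E M) where
  toEnd : EndTM E M
  isInvertible : ∀ x, (toEnd x).IsInvertible
  anchor_comp : ∀ (x : M) (v : TangentSpace 𝓘(ℝ, E) x), 𝓑.anchor x (toEnd x v) = 𝓐.anchor x v
  map_bracket : ∀ X Y,
    applyEnd toEnd (𝓐.bracket X Y) = 𝓑.bracket (applyEnd toEnd X) (applyEnd toEnd Y)

/-- The Lie algebroid structure `𝓐` on `TM`, with anchor `q` and bracket `⟦ , ⟧`, is the one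
determined by the degree one derivation `D` of `Ω(M)`:
`q(X)(f) = Df (X)` for all functions `f`, and
`α (⟦X, Y⟧) = D(α(Y)) (X) - D(α(X)) (Y) - Dα (X, Y)` for all one-forms `α`. -/
structure LieAlgebroidTM.IsDeterminedBy (𝓐 : LieAlgebroidTM E M)
    (D : ∀ {k : ℕ}, DiffForm E M k → DiffForm E M (k + 1)) : Prop where
  anchor_eq : ∀ (X : VField E M) (f : C^∞⟮𝓘(ℝ, E), M; ℝ⟯) (x : M),
    dirDeriv (applyEnd 𝓐.anchor X) f x = (D (ofFun f)).1 x ![X x]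
  bracket_eq : ∀ (X Y : VField E M) (α : DiffForm E M 1) (x : M),
    α.1 x ![𝓐.bracket X Y x] =
      (D (interior Y α)).1 x ![X x] - (D (interior X α)).1 x ![Y x] - (D α).1 x ![X x, Y x]

end Manifold
end TangentAlgebroid
end

/-!
If `K L = -T_K`, then `D = 𝓛_K + i_L` is conjugate to `d` under the pullback
`K^* α = α (K ·, …, K ·)`: in a chart, `D K^* α - K^* dα` is the alternation of a bilinear defect
built from `K`, its derivative and `L`, and the defect is symmetric exactly when `K L = -T_K`. Hence
`D² = K^* d² (K^*)⁻¹ = 0`. Conversely, `D² f (X, Y) = df (K L (X, Y) + T_K (X, Y))` on functions,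
and differentials of functions separate tangent vectors.

On one-forms, `D` satisfies the Cartan formula with the bracket `[X, Y]_K - L (X, Y)`, where
`[X, Y]_K = [K X, Y] + [X, K Y] - K [X, Y]`. Since `K [X, Y]_K = [K X, K Y] - T_K (X, Y)`, this
bracket is `K⁻¹ [K X, K Y]` once `L = -K⁻¹ T_K`, so that `K` carries it to the Lie bracket.
-/

noncomputable section

namespace TangentAlgebroid

section Pointwise

variable {E : Type*} [NormedAddCommGroup E] [NormedSpace ℝ E]

theorem insertEnd_one_apply (A : E →L[ℝ] E) (η : E [⋀^Fin 1]→L[ℝ] ℝ) (u : E) :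
    insertEnd A 1 η ![u] = η ![A u] := by
  have update_zero : Function.update ![u] 0 (A u) = ![A u] := by
    ext i; fin_cases i; rfl
  simp [insertEnd_apply, update_zero]

theorem insertEnd_two_apply (A : E →L[ℝ] E) (η : E [⋀^Fin 2]→L[ℝ] ℝ) (u w : E) :
    insertEnd A 2 η ![u, w] = η ![A u, w] + η ![u, A w] := by
  have update_one : Function.update ![u, w] 1 (A w) = ![u, A w] := by
    ext i; fin_cases i <;> rfl
  have update_zero : Function.update ![u, w] 0 (A u) = ![A u, w] := by
    ext i; fin_cases i <;> rfl
  simp [insertEnd_apply, Fin.sum_univ_two, update_zero, update_one]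

theorem insertBilin_one_apply {B : E →L[ℝ] E →L[ℝ] E} (hB : ∀ v, B v v = 0)
    (η : E [⋀^Fin 1]→L[ℝ] ℝ) (u w : E) :
    insertBilin B 1 η ![u, w] = η ![B u w] := by
  simp [insertBilin_apply B hB]

theorem insertEnd_alternatizeUncurryFin (A : E →L[ℝ] E) {k : ℕ}
    (f : E →L[ℝ] E [⋀^Fin k]→L[ℝ] ℝ) (v : Fin (k + 1) → E) :
    insertEnd A (k + 1) (.alternatizeUncurryFin f) v = ∑ i : Fin (k + 1), (-1 : ℤ) ^ (i : ℕ) •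
      (f (A (v i)) (i.removeNth v) + insertEnd A k (f (v i)) (i.removeNth v)) := by
  have insertEnd_sum (θ : E [⋀^Fin k]→L[ℝ] ℝ) (w : Fin k → E) :
      insertEnd A k θ w = ∑ i, θ (Function.update w i (A (w i))) := by
    cases k with
    | zero => simp [insertEnd]
    | succ k => exact insertEnd_apply A k θ w
  simp only [insertEnd_apply, insertEnd_sum, ContinuousAlternatingMap.alternatizeUncurryFin_apply]
  rw [Finset.sum_comm]
  refine Finset.sum_congr rfl fun i _ => ?_
  rw [← Finset.smul_sum, Fin.sum_univ_succAbove _ i]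
  congr 2
  · simp
  · refine Finset.sum_congr rfl fun j _ => ?_
    rw [Function.update_of_ne (Fin.ne_succAbove i j)]
    congr 1
    ext l
    simp [Fin.removeNth, Function.update_apply]

theorem insertBilin_eq_sum_insertEnd (B : E →L[ℝ] E →L[ℝ] E) {k : ℕ} (η : E [⋀^Fin k]→L[ℝ] ℝ)
    (v : Fin (k + 1) → E) :
    insertBilin B k η v = ∑ i : Fin (k + 1), (-1 : ℤ) ^ (i : ℕ) •
      ((1 / 2 : ℝ) * insertEnd (B (v i)) k η (i.removeNth v)) := by
  cases k with
  | zero => simp [insertBilin, insertEnd]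
  | succ k =>
    simp only [insertBilin, ContinuousAlternatingMap.smul_apply,
      ContinuousAlternatingMap.alternatizeUncurryFin_apply (_ ∘L _), Finset.smul_sum,
      smul_comm (1 / 2 : ℝ)]
    rfl

theorem insertEnd_compContinuousLinearMap (A R : E →L[ℝ] E) {k : ℕ} (η : E [⋀^Fin k]→L[ℝ] ℝ) :
    insertEnd R k (η.compContinuousLinearMap A) = η.fderivCompContinuousLinearMap A (A ∘L R) := by
  ext v
  cases k with
  | zero => simp [insertEnd]
  | succ k =>
    rw [insertEnd_apply, ContinuousAlternatingMap.fderivCompContinuousLinearMap_apply]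
    refine Finset.sum_congr rfl fun i _ => congrArg η (funext fun j => ?_)
    obtain rfl | hj := eq_or_ne j i <;> simp [*]

end Pointwise

section Local

variable {E : Type*} [NormedAddCommGroup E] [NormedSpace ℝ E]

theorem extDeriv_zero_form_apply {θ : E → E [⋀^Fin 0]→L[ℝ] ℝ} {x : E}
    (hθ : DifferentiableAt ℝ θ x) (u : E) :
    extDeriv θ x ![u] = fderiv ℝ (fun y => θ y ![]) x u := by
  rw [fderiv_continuousAlternatingMap_apply_const_apply hθ, extDeriv,
    ContinuousAlternatingMap.alternatizeUncurryFin_apply, Fin.sum_univ_one]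
  simp [Subsingleton.elim _ ![]]

theorem extDeriv_one_form_apply {η : E → E [⋀^Fin 1]→L[ℝ] ℝ} {X Y : E → E} {x : E}
    (hη : DifferentiableAt ℝ η x) (hX : DifferentiableAt ℝ X x) (hY : DifferentiableAt ℝ Y x) :
    extDeriv η x ![X x, Y x] = fderiv ℝ (fun y => η y ![Y y]) x (X x)
      - fderiv ℝ (fun y => η y ![X y]) x (Y x) - η x ![VectorField.lieBracket ℝ X Y x] := by
  have eval_pair (y : E) : (fun i => ![X, Y] i y) = ![X y, Y y] := by
    ext i; fin_cases i <;> rfl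
  have removeNth_zero (y : E) : Fin.removeNth (0 : Fin 2) (fun i => ![X, Y] i y) = ![Y y] := by
    ext i; fin_cases i; rfl
  have removeNth_one (y : E) : Fin.removeNth (1 : Fin 2) (fun i => ![X, Y] i y) = ![X y] := by
    ext i; fin_cases i; rfl
  rw [← eval_pair]
  refine (extDeriv_apply_vectorField (V := ![X, Y]) hη
    (by simp [Fin.forall_fin_two, hX, hY])).trans (congrArg₂ (· - ·)
      ((Fin.sum_univ_two _).trans ?_) ?_)
  · simp only [removeNth_zero, removeNth_one]
    simp [sub_eq_add_neg]
  · simp [Matrix.empty_eq]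

theorem fderiv_insertEnd_apply {A : E → E →L[ℝ] E} {k : ℕ} {η : E → E [⋀^Fin k]→L[ℝ] ℝ} {x : E}
    (hA : DifferentiableAt ℝ A x) (hη : DifferentiableAt ℝ η x) (u : E) :
    fderiv ℝ (fun y => insertEnd (A y) k (η y)) x u =
      insertEnd (fderiv ℝ A x u) k (η x) + insertEnd (A x) k (fderiv ℝ η x u) := by
  cases k with
  | zero => simp [insertEnd]
  | succ k =>
    have hcurry := HasFDerivAt.comp (F := E [⋀^Fin (k + 1)]→L[ℝ] ℝ)
      (G := E →L[ℝ] E [⋀^Fin k]→L[ℝ] ℝ) x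
      ContinuousAlternatingMap.curryLeftLI.toContinuousLinearMap.hasFDerivAt hη.hasFDerivAt
    have hcomp := hcurry.clm_comp hA.hasFDerivAt
    have h := (ContinuousAlternatingMap.alternatizeUncurryFinCLM ℝ E ℝ).hasFDerivAt.comp x hcomp
    refine (congrArg (fun T => T u) h.fderiv).trans ?_
    simp only [ContinuousLinearMap.comp_apply, _root_.add_apply, map_add]
    rfl

/-- The local expression of the derivation `𝓛_A + i_B`. -/
def localFnDer (A : E → E →L[ℝ] E) (B : E → E →L[ℝ] E →L[ℝ] E) {k : ℕ}
    (η : E → E [⋀^Fin k]→L[ℝ] ℝ) (x : E) : E [⋀^Fin (k + 1)]→L[ℝ] ℝ :=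
  insertEnd (A x) (k + 1) (extDeriv η x) - extDeriv (fun y => insertEnd (A y) k (η y)) x
    + insertBilin (B x) k (η x)

theorem localFnDer_congr_of_eventuallyEq (A : E → E →L[ℝ] E) (B : E → E →L[ℝ] E →L[ℝ] E) {k : ℕ}
    {η θ : E → E [⋀^Fin k]→L[ℝ] ℝ} {x : E} (h : η =ᶠ[nhds x] θ) :
    localFnDer A B η x = localFnDer A B θ x := by
  have h_insertEnd : (fun y => insertEnd (A y) k (η y)) =ᶠ[nhds x]
      fun y => insertEnd (A y) k (θ y) :=
    h.mono fun y hy => by simp only [hy]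
  simp only [localFnDer, h.extDeriv_eq, h_insertEnd.extDeriv_eq, h.eq_of_nhds]

theorem localFnDer_apply {A : E → E →L[ℝ] E} (B : E → E →L[ℝ] E →L[ℝ] E) {k : ℕ}
    {η : E → E [⋀^Fin k]→L[ℝ] ℝ} {x : E} (hA : DifferentiableAt ℝ A x)
    (hη : DifferentiableAt ℝ η x) (v : Fin (k + 1) → E) :
    localFnDer A B η x v = ∑ i : Fin (k + 1), (-1 : ℤ) ^ (i : ℕ) •
      (fderiv ℝ η x (A x (v i)) (i.removeNth v)
        - insertEnd (fderiv ℝ A x (v i)) k (η x) (i.removeNth v)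
        + (1 / 2 : ℝ) * insertEnd (B x (v i)) k (η x) (i.removeNth v)) := by
  simp only [localFnDer, extDeriv, ContinuousAlternatingMap.add_apply,
    ContinuousAlternatingMap.sub_apply, insertEnd_alternatizeUncurryFin,
    ContinuousAlternatingMap.alternatizeUncurryFin_apply, fderiv_insertEnd_apply hA hη,
    insertBilin_eq_sum_insertEnd]
  rw [← Finset.sum_sub_distrib, ← Finset.sum_add_distrib]
  refine Finset.sum_congr rfl fun i _ => ?_
  rw [← smul_sub, ← smul_add]
  congr 1
  ring

/-- The Nijenhuis torsion of `A` at `x`, evaluated on constant vector fields. -/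
def localTorsion (A : E → E →L[ℝ] E) (x u w : E) : E :=
  fderiv ℝ A x (A x u) w - fderiv ℝ A x (A x w) u - A x (fderiv ℝ A x u w)
    + A x (fderiv ℝ A x w u)

theorem lieBracket_torsion_eq_localTorsion {A : E → E →L[ℝ] E} {X Y : E → E} {x : E}
    (hA : DifferentiableAt ℝ A x) (hX : DifferentiableAt ℝ X x) (hY : DifferentiableAt ℝ Y x) :
    VectorField.lieBracket ℝ (fun y => A y (X y)) (fun y => A y (Y y)) x
      - A x (VectorField.lieBracket ℝ (fun y => A y (X y)) Y x)
      - A x (VectorField.lieBracket ℝ X (fun y => A y (Y y)) x)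
      + A x (A x (VectorField.lieBracket ℝ X Y x)) = localTorsion A x (X x) (Y x) := by
  simp only [VectorField.lieBracket, fderiv_clm_apply hA hX, fderiv_clm_apply hA hY,
    _root_.add_apply, ContinuousLinearMap.comp_apply, ContinuousLinearMap.flip_apply, map_sub,
    map_add, localTorsion]
  abel

/-- The bilinear map `(u, w) ↦ (∂_{A u} A) w - A (∂_u A) w + ½ A (B (u, w))`, by which `𝓛_A + i_B`
fails to intertwine the pullback along `A` with the exterior derivative. -/
def intertwiningDefect (A : E → E →L[ℝ] E) (B : E → E →L[ℝ] E →L[ℝ] E) (x : E) :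
    E →L[ℝ] E →L[ℝ] E :=
  fderiv ℝ A x ∘L A x
    + ContinuousLinearMap.compL ℝ E E E (A x) ∘L ((1 / 2 : ℝ) • B x - fderiv ℝ A x)

theorem intertwiningDefect_apply (A : E → E →L[ℝ] E) (B : E → E →L[ℝ] E →L[ℝ] E) (x u : E) :
    intertwiningDefect A B x u = fderiv ℝ A x (A x u)
      - A x ∘L fderiv ℝ A x u + (1 / 2 : ℝ) • (A x ∘L B x u) := by
  ext w
  simp only [intertwiningDefect, _root_.add_apply, _root_.sub_apply, _root_.smul_apply,
    ContinuousLinearMap.comp_apply, ContinuousLinearMap.compL_apply, map_sub, map_smul]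
  abel

theorem intertwiningDefect_comm {A : E → E →L[ℝ] E} {B : E → E →L[ℝ] E →L[ℝ] E} {x : E}
    (hB : ∀ u w, A x (B x u w) = -localTorsion A x u w) (u w : E) :
    intertwiningDefect A B x u w = intertwiningDefect A B x w u := by
  simp only [intertwiningDefect_apply, _root_.add_apply, _root_.sub_apply, _root_.smul_apply,
    ContinuousLinearMap.comp_apply, hB, localTorsion]
  module

theorem localFnDer_compContinuousLinearMap {A : E → E →L[ℝ] E} (B : E → E →L[ℝ] E →L[ℝ] E) {k : ℕ}
    {η : E → E [⋀^Fin k]→L[ℝ] ℝ} {x : E} (hA : DifferentiableAt ℝ A x)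
    (hη : DifferentiableAt ℝ η x) :
    localFnDer A B (fun y => (η y).compContinuousLinearMap (A y)) x =
      (extDeriv η x).compContinuousLinearMap (A x) + .alternatizeUncurryFin
        ((η x).fderivCompContinuousLinearMap (A x) ∘L intertwiningDefect A B x) := by
  ext v
  rw [localFnDer_apply B hA (hη.continuousAlternatingMapCompContinuousLinearMap hA),
    fderiv_continuousAlternatingMapCompContinuousLinearMap hη hA,
    ContinuousAlternatingMap.add_apply, ContinuousAlternatingMap.compContinuousLinearMap_apply,
    extDeriv, ContinuousAlternatingMap.alternatizeUncurryFin_apply,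
    ContinuousAlternatingMap.alternatizeUncurryFin_apply, ← Finset.sum_add_distrib]
  refine Finset.sum_congr rfl fun i _ => ?_
  rw [← smul_add]
  congr 1
  simp only [insertEnd_compContinuousLinearMap, ContinuousLinearMap.comp_apply, _root_.add_apply,
    intertwiningDefect_apply, map_add, map_sub, map_smul, ContinuousAlternatingMap.add_apply,
    ContinuousAlternatingMap.sub_apply, ContinuousAlternatingMap.smul_apply, smul_eq_mul,
    ← add_assoc, ← add_sub_assoc]
  rfl

theorem localFnDer_compContinuousLinearMap_of_eq_neg_torsion {A : E → E →L[ℝ] E}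
    {B : E → E →L[ℝ] E →L[ℝ] E} {k : ℕ} {η : E → E [⋀^Fin k]→L[ℝ] ℝ} {x : E}
    (hA : DifferentiableAt ℝ A x) (hη : DifferentiableAt ℝ η x)
    (hB : ∀ u w, A x (B x u w) = -localTorsion A x u w) :
    localFnDer A B (fun y => (η y).compContinuousLinearMap (A y)) x =
      (extDeriv η x).compContinuousLinearMap (A x) := by
  rw [localFnDer_compContinuousLinearMap B hA hη,
    ContinuousAlternatingMap.alternatizeUncurryFin_fderivCompContinuousLinearMap_eq_zero _ _
      (intertwiningDefect_comm hB), add_zero]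

theorem contDiffOn_compContinuousLinearMap [FiniteDimensional ℝ E] {P : E → E →L[ℝ] E} {s : Set E}
    (hP : ContDiffOn ℝ ∞ P s) : ∀ {k : ℕ} {η : E → E [⋀^Fin k]→L[ℝ] ℝ}, ContDiffOn ℝ ∞ η s →
      ContDiffOn ℝ ∞ (fun y => (η y).compContinuousLinearMap (P y)) s
  | 0, η, hη => hη.congr fun y _ => by
      ext v
      exact congrArg (η y) (Subsingleton.elim _ _)
  | k + 1, η, hη => by
    -- Alternatizing `η.curryLeft` gives `(k + 1) • η`, which reduces the claim to degree `k`.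
    have contDiffOn_curryLeft :
        ContDiffOn ℝ ∞ (fun y => ((η y).compContinuousLinearMap (P y)).curryLeft) s := by
      rw [contDiffOn_clm_apply]
      intro u
      refine (contDiffOn_compContinuousLinearMap hP
        ((contDiff_curryLeft.comp_contDiffOn hη).clm_apply
          (hP.clm_apply (contDiffOn_const (c := u))))).congr fun y _ => ?_
      exact ContinuousAlternatingMap.curryLeft_compContinuousLinearMap _ _ _
    refine (((ContinuousAlternatingMap.alternatizeUncurryFinCLM ℝ E ℝ
      (n := k)).contDiff.comp_contDiffOn contDiffOn_curryLeft).const_smul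
        ((k + 1 : ℝ)⁻¹)).congr fun y _ => ?_
    rw [eq_inv_smul_iff₀ (by positivity)]
    have h := ContinuousAlternatingMap.alternatizeUncurryFin_curryLeft
      ((η y).compContinuousLinearMap (P y))
    rw [← Nat.cast_smul_eq_nsmul ℝ, Nat.cast_add_one] at h
    exact h.symm

end Local

section Charts

variable {E : Type*} [NormedAddCommGroup E] [NormedSpace ℝ E]

theorem mlieBracket_eq_lieBracket (V W : ∀ y : E, TangentSpace 𝓘(ℝ, E) y) (y : E) :
    VectorField.mlieBracket 𝓘(ℝ, E) V W y = VectorField.lieBracket ℝ (E := E) V W y := by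
  rw [← VectorField.mlieBracketWithin_univ, VectorField.mlieBracketWithin_eq_lieBracketWithin]
  exact congrFun (VectorField.lieBracketWithin_univ (E := E) (V := V) (W := W)) y

variable {M : Type*} [TopologicalSpace M] [ChartedSpace E M]

theorem target_mem_nhds {x₀ : M} {y : E} (hy : y ∈ (extChartAt 𝓘(ℝ, E) x₀).target) :
    (extChartAt 𝓘(ℝ, E) x₀).target ∈ nhds y :=
  (isOpen_extChartAt_target x₀).mem_nhds hy

theorem contDiffAt_inChart {k : ℕ} (α : DiffForm E M k) {x₀ : M} {y : E}
    (hy : y ∈ (extChartAt 𝓘(ℝ, E) x₀).target) : ContDiffAt ℝ ∞ (inChart α.1 x₀) y :=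
  (α.2 x₀).contDiffAt (target_mem_nhds hy)

theorem differentiableAt_inChart {k : ℕ} (α : DiffForm E M k) {x₀ : M} {y : E}
    (hy : y ∈ (extChartAt 𝓘(ℝ, E) x₀).target) : DifferentiableAt ℝ (inChart α.1 x₀) y :=
  (contDiffAt_inChart α hy).differentiableAt (by simp)

theorem exists_eq_extChartAt_symm (x : M) :
    ∃ (x₀ : M) (y : E), y ∈ (extChartAt 𝓘(ℝ, E) x₀).target ∧
      (extChartAt 𝓘(ℝ, E) x₀).symm y = x :=
  ⟨x, _, mem_extChartAt_target x, extChartAt_to_inv x⟩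

variable [IsManifold 𝓘(ℝ, E) ∞ M]

theorem chartDInv_chartD_apply {x₀ : M} {y : E} (hy : y ∈ (extChartAt 𝓘(ℝ, E) x₀).target)
    (v : E) : chartDInv x₀ y (chartD x₀ y v) = v :=
  congrArg (fun f : E →L[ℝ] E => f v) (chartDInv_comp x₀ hy)

theorem chartD_chartDInv_apply {x₀ : M} {y : E} (hy : y ∈ (extChartAt 𝓘(ℝ, E) x₀).target)
    (v : E) : chartD x₀ y (chartDInv x₀ y v) = v :=
  congrArg (fun f : E →L[ℝ] E => f v) (chartD_comp x₀ hy)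

theorem apply_eq_inChart {k : ℕ} (α : DiffForm E M k) {x₀ : M} {y : E}
    (hy : y ∈ (extChartAt 𝓘(ℝ, E) x₀).target)
    (v : Fin k → TangentSpace 𝓘(ℝ, E) ((extChartAt 𝓘(ℝ, E) x₀).symm y)) :
    α.1 ((extChartAt 𝓘(ℝ, E) x₀).symm y) v =
      inChart α.1 x₀ y (fun i => chartD x₀ y (v i)) :=
  congrArg (α.1 ((extChartAt 𝓘(ℝ, E) x₀).symm y))
    (funext fun i => (chartDInv_chartD_apply hy (v i)).symm)

theorem one_form_apply_eq_inChart (α : DiffForm E M 1) {x₀ : M} {y : E}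
    (hy : y ∈ (extChartAt 𝓘(ℝ, E) x₀).target)
    (v : TangentSpace 𝓘(ℝ, E) ((extChartAt 𝓘(ℝ, E) x₀).symm y)) :
    α.1 ((extChartAt 𝓘(ℝ, E) x₀).symm y) ![v] = inChart α.1 x₀ y ![chartD x₀ y v] := by
  rw [apply_eq_inChart α hy]
  exact congrArg (inChart α.1 x₀ y) (funext fun i => by fin_cases i; rfl)

theorem two_form_apply_eq_inChart (α : DiffForm E M 2) {x₀ : M} {y : E}
    (hy : y ∈ (extChartAt 𝓘(ℝ, E) x₀).target)
    (u v : TangentSpace 𝓘(ℝ, E) ((extChartAt 𝓘(ℝ, E) x₀).symm y)) :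
    α.1 ((extChartAt 𝓘(ℝ, E) x₀).symm y) ![u, v] =
      inChart α.1 x₀ y ![chartD x₀ y u, chartD x₀ y v] := by
  rw [apply_eq_inChart α hy]
  exact congrArg (inChart α.1 x₀ y) (funext fun i => by fin_cases i <;> rfl)

theorem eq_of_inChart_eq {k : ℕ} {α β : DiffForm E M k}
    (h : ∀ (x₀ : M), ∀ y ∈ (extChartAt 𝓘(ℝ, E) x₀).target,
      inChart α.1 x₀ y = inChart β.1 x₀ y) : α = β := by
  ext x v
  obtain ⟨x₀, y, hy, rfl⟩ := exists_eq_extChartAt_symm (E := E) x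
  rw [apply_eq_inChart α hy, apply_eq_inChart β hy, h x₀ y hy]

/-- The expression of a vector field in the chart at `x₀`. -/
def fieldInChart (X : VField E M) (x₀ : M) (y : E) : E :=
  chartD x₀ y (X ((extChartAt 𝓘(ℝ, E) x₀).symm y))

theorem differentiableAt_fieldInChart (X : VField E M) {x₀ : M} {y : E}
    (hy : y ∈ (extChartAt 𝓘(ℝ, E) x₀).target) : DifferentiableAt ℝ (fieldInChart X x₀) y :=
  ((contDiffOn_chartD x₀ X.contMDiff.contMDiffOn).contDiffAt (target_mem_nhds hy)).differentiableAt
    (by simp)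

theorem mpullback_eventuallyEq_fieldInChart (X : VField E M) {x₀ : M} {y : E}
    (hy : y ∈ (extChartAt 𝓘(ℝ, E) x₀).target) :
    VectorField.mpullback 𝓘(ℝ, E) 𝓘(ℝ, E) (extChartAt 𝓘(ℝ, E) x₀).symm X
      =ᶠ[nhds y] fieldInChart X x₀ :=
  Filter.eventually_of_mem (target_mem_nhds hy) fun z hz =>
    congrArg (fun f : E →L[ℝ] E => f (X ((extChartAt 𝓘(ℝ, E) x₀).symm z)))
      (ContinuousLinearMap.inverse_eq (f := chartDInv x₀ z) (g := chartD x₀ z)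
        (chartDInv_comp x₀ hz) (chartD_comp x₀ hz))

theorem endInChart_chartD_apply (K : EndTM E M) {x₀ : M} {y : E}
    (hy : y ∈ (extChartAt 𝓘(ℝ, E) x₀).target)
    (v : TangentSpace 𝓘(ℝ, E) ((extChartAt 𝓘(ℝ, E) x₀).symm y)) :
    endInChart K x₀ y (chartD x₀ y v) =
      chartD x₀ y (K ((extChartAt 𝓘(ℝ, E) x₀).symm y) v) :=
  congrArg (fun w : E => chartD x₀ y
    ((show E →L[ℝ] E from K ((extChartAt 𝓘(ℝ, E) x₀).symm y)) w)) (chartDInv_chartD_apply hy v)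

theorem fieldInChart_applyEnd (K : EndTM E M) (X : VField E M) {x₀ : M} {y : E}
    (hy : y ∈ (extChartAt 𝓘(ℝ, E) x₀).target) :
    fieldInChart (applyEnd K X) x₀ y = endInChart K x₀ y (fieldInChart X x₀ y) :=
  (endInChart_chartD_apply K hy _).symm

theorem inChart_interior_apply (X : VField E M) (α : DiffForm E M 1) {x₀ : M} {y : E}
    (hy : y ∈ (extChartAt 𝓘(ℝ, E) x₀).target) :
    inChart (interior X α).1 x₀ y ![] = inChart α.1 x₀ y ![fieldInChart X x₀ y] :=
  congrArg (fun θ : E [⋀^Fin 0]→L[ℝ] ℝ => θ ![])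
    (curryLeft_comp (E := E) _ (chartDInv x₀ y) (chartD x₀ y) (chartDInv_comp x₀ hy) _)

theorem bilinInChart_fieldInChart (L : VectorTwoForm E M) (X Y : VField E M) {x₀ : M} {y : E}
    (hy : y ∈ (extChartAt 𝓘(ℝ, E) x₀).target) :
    bilinInChart L x₀ y (fieldInChart X x₀ y) (fieldInChart Y x₀ y) =
      chartD x₀ y (L.toSection ((extChartAt 𝓘(ℝ, E) x₀).symm y)
        (X ((extChartAt 𝓘(ℝ, E) x₀).symm y)) (Y ((extChartAt 𝓘(ℝ, E) x₀).symm y))) :=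
  congrArg₂ (fun u w : E => chartD x₀ y ((show E →L[ℝ] E →L[ℝ] E from
    L.toSection ((extChartAt 𝓘(ℝ, E) x₀).symm y)) u w))
    (chartDInv_chartD_apply hy _) (chartDInv_chartD_apply hy _)

theorem inChart_extD {k : ℕ} (α : DiffForm E M k) {x₀ : M} {y : E}
    (hy : y ∈ (extChartAt 𝓘(ℝ, E) x₀).target) :
    inChart (extD α).1 x₀ y = extDeriv (inChart α.1 x₀) y :=
  inChart_rawExtD α x₀ hy

theorem extD_zero_form_apply (β : DiffForm E M 0) {x₀ : M} {y : E}
    (hy : y ∈ (extChartAt 𝓘(ℝ, E) x₀).target)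
    (v : TangentSpace 𝓘(ℝ, E) ((extChartAt 𝓘(ℝ, E) x₀).symm y)) :
    (extD β).1 ((extChartAt 𝓘(ℝ, E) x₀).symm y) ![v] =
      fderiv ℝ (fun z => inChart β.1 x₀ z ![]) y (chartD x₀ y v) := by
  rw [one_form_apply_eq_inChart _ hy, inChart_extD β hy, extDeriv_zero_form_apply
    (differentiableAt_inChart β hy)]

theorem fderiv_comp_extChartAt_symm (f : C^∞⟮𝓘(ℝ, E), M; ℝ⟯) {x₀ : M} {y : E}
    (hy : y ∈ (extChartAt 𝓘(ℝ, E) x₀).target) (u : E) :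
    fderiv ℝ (fun z => f ((extChartAt 𝓘(ℝ, E) x₀).symm z)) y u =
      mfderiv 𝓘(ℝ, E) 𝓘(ℝ, ℝ) f ((extChartAt 𝓘(ℝ, E) x₀).symm y) (chartDInv x₀ y u) := by
  have h := mfderiv_comp (I := 𝓘(ℝ, E)) (I' := 𝓘(ℝ, E)) (I'' := 𝓘(ℝ, ℝ)) (g := f) y
    (f.contMDiff.contMDiffAt.mdifferentiableAt (by simp))
    (((contMDiffOn_extChartAt_symm (I := 𝓘(ℝ, E)) (n := ∞) x₀).contMDiffAt
      (target_mem_nhds hy)).mdifferentiableAt (by simp))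
  rw [mfderiv_eq_fderiv] at h
  exact congrArg (fun T : E →L[ℝ] ℝ => T u) h

theorem extD_ofFun_apply (f : C^∞⟮𝓘(ℝ, E), M; ℝ⟯) (x : M) (v : TangentSpace 𝓘(ℝ, E) x) :
    (extD (ofFun f)).1 x ![v] = mfderiv 𝓘(ℝ, E) 𝓘(ℝ, ℝ) f x v := by
  obtain ⟨x₀, y, hy, rfl⟩ := exists_eq_extChartAt_symm (E := E) x
  rw [extD_zero_form_apply _ hy]
  exact (fderiv_comp_extChartAt_symm f hy _).trans
    (congrArg (mfderiv 𝓘(ℝ, E) 𝓘(ℝ, ℝ) f ((extChartAt 𝓘(ℝ, E) x₀).symm y))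
      (chartDInv_chartD_apply hy v))

variable [FiniteDimensional ℝ E]

theorem fieldInChart_lieBracket (X Y : VField E M) {x₀ : M} {y : E}
    (hy : y ∈ (extChartAt 𝓘(ℝ, E) x₀).target) :
    fieldInChart (lieBracket X Y) x₀ y =
      VectorField.lieBracket ℝ (fieldInChart X x₀) (fieldInChart Y x₀) y := by
  have := isManifold_two E M
  have : CompleteSpace E := FiniteDimensional.complete ℝ E
  have mpullback_lieBracket := VectorField.mpullback_mlieBracket (n := ∞)
    (mdifferentiableAt_field X _) (mdifferentiableAt_field Y _)
    ((contMDiffOn_extChartAt_symm (I := 𝓘(ℝ, E)) (n := ∞) x₀).contMDiffAt (target_mem_nhds hy))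
    (by simpa using (ENat.LEInfty.out : (2 : ℕ∞ω) ≤ ∞))
  have mlieBracket_fieldInChart :=
    (mpullback_eventuallyEq_fieldInChart X hy).mlieBracket_vectorField_eq
      (mpullback_eventuallyEq_fieldInChart Y hy)
  exact (mpullback_eventuallyEq_fieldInChart (lieBracket X Y) hy).eq_of_nhds.symm.trans
    ((mpullback_lieBracket.trans mlieBracket_fieldInChart).trans (mlieBracket_eq_lieBracket _ _ y))

theorem differentiableAt_endInChart (K : EndTM E M) {x₀ : M} {y : E}
    (hy : y ∈ (extChartAt 𝓘(ℝ, E) x₀).target) : DifferentiableAt ℝ (endInChart K x₀) y :=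
  ((contDiffOn_endInChart K x₀).contDiffAt (target_mem_nhds hy)).differentiableAt (by simp)

theorem fieldInChart_torsion (K : EndTM E M) (X Y : VField E M) {x₀ : M} {y : E}
    (hy : y ∈ (extChartAt 𝓘(ℝ, E) x₀).target) :
    fieldInChart (torsion K X Y) x₀ y =
      localTorsion (endInChart K x₀) y (fieldInChart X x₀ y) (fieldInChart Y x₀ y) := by
  have eventuallyEq_applyEnd (Z : VField E M) : fieldInChart (applyEnd K Z) x₀ =ᶠ[nhds y]
      fun z => endInChart K x₀ z (fieldInChart Z x₀ z) :=
    Filter.eventually_of_mem (target_mem_nhds hy) fun z hz => fieldInChart_applyEnd K Z hz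
  have fieldInChart_expand : fieldInChart (torsion K X Y) x₀ y =
      fieldInChart (lieBracket (applyEnd K X) (applyEnd K Y)) x₀ y
      - fieldInChart (applyEnd K (lieBracket (applyEnd K X) Y)) x₀ y
      - fieldInChart (applyEnd K (lieBracket X (applyEnd K Y))) x₀ y
      + fieldInChart (applyEnd K (applyEnd K (lieBracket X Y))) x₀ y := by
    refine ((chartD x₀ y).map_add _ _).trans (congrArg (· + _) ?_)
    exact ((chartD x₀ y).map_sub _ _).trans (congrArg (· - _) ((chartD x₀ y).map_sub _ _))
  rw [fieldInChart_expand, ← lieBracket_torsion_eq_localTorsion (differentiableAt_endInChart K hy)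
    (differentiableAt_fieldInChart X hy) (differentiableAt_fieldInChart Y hy)]
  simp only [fieldInChart_applyEnd K _ hy, fieldInChart_lieBracket _ _ hy]
  rw [(eventuallyEq_applyEnd X).lieBracket_vectorField_eq (eventuallyEq_applyEnd Y),
    (eventuallyEq_applyEnd X).lieBracket_vectorField_eq .rfl,
    Filter.EventuallyEq.rfl.lieBracket_vectorField_eq (eventuallyEq_applyEnd Y)]

theorem inChart_iotaEnd (K : EndTM E M) {k : ℕ} (α : DiffForm E M k) {x₀ : M} {y : E}
    (hy : y ∈ (extChartAt 𝓘(ℝ, E) x₀).target) :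
    inChart (iotaEnd K α).1 x₀ y = insertEnd (endInChart K x₀ y) k (inChart α.1 x₀ y) :=
  insertEnd_comp (E := E) _ (chartDInv x₀ y) (chartD x₀ y) (chartDInv_comp x₀ hy) k _

theorem inChart_iotaTwo (L : VectorTwoForm E M) {k : ℕ} (α : DiffForm E M k) {x₀ : M} {y : E}
    (hy : y ∈ (extChartAt 𝓘(ℝ, E) x₀).target) :
    inChart (iotaTwo L α).1 x₀ y = insertBilin (bilinInChart L x₀ y) k (inChart α.1 x₀ y) :=
  insertBilin_comp (E := E) _ (chartDInv x₀ y) _ (fun _ _ => chartDInv_chartD_apply hy _) k _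

theorem inChart_fnDer (K : EndTM E M) (L : VectorTwoForm E M) {k : ℕ} (α : DiffForm E M k)
    {x₀ : M} {y : E} (hy : y ∈ (extChartAt 𝓘(ℝ, E) x₀).target) :
    inChart (fnDer K L α).1 x₀ y =
      localFnDer (endInChart K x₀) (bilinInChart L x₀) (inChart α.1 x₀) y := by
  have eventuallyEq_iotaEnd : inChart (iotaEnd K α).1 x₀ =ᶠ[nhds y]
      fun z => insertEnd (endInChart K x₀ z) k (inChart α.1 x₀ z) :=
    Filter.eventually_of_mem (target_mem_nhds hy) fun z hz => inChart_iotaEnd K α hz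
  have inChart_expand : inChart (fnDer K L α).1 x₀ y = inChart (iotaEnd K (extD α)).1 x₀ y
      - inChart (extD (iotaEnd K α)).1 x₀ y + inChart (iotaTwo L α).1 x₀ y := rfl
  rw [inChart_expand, inChart_iotaEnd K _ hy, inChart_extD α hy, inChart_extD _ hy,
    inChart_iotaTwo L α hy, eventuallyEq_iotaEnd.extDeriv_eq, localFnDer]

end Charts

section Cartan

variable {E : Type*} [NormedAddCommGroup E] [NormedSpace ℝ E]
  {M : Type*} [TopologicalSpace M] [ChartedSpace E M] [IsManifold 𝓘(ℝ, E) ∞ M]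

theorem extD_extD {k : ℕ} (α : DiffForm E M k) : extD (extD α) = 0 := by
  refine eq_of_inChart_eq fun x₀ y hy => ?_
  have inChart_extD_eventuallyEq : inChart (extD α).1 x₀ =ᶠ[nhds y] extDeriv (inChart α.1 x₀) :=
    Filter.eventually_of_mem (target_mem_nhds hy) fun z hz => inChart_extD α hz
  rw [inChart_extD _ hy, inChart_extD_eventuallyEq.extDeriv_eq,
    extDeriv_extDeriv_apply (contDiffAt_inChart α hy)
      (by simpa using (ENat.LEInfty.out : (2 : ℕ∞ω) ≤ ∞))]
  rfl

theorem extD_zero {k : ℕ} : extD (0 : DiffForm E M k) = 0 := by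
  refine eq_of_inChart_eq fun x₀ y hy => ?_
  rw [inChart_extD _ hy]
  have inChart_zero : inChart (0 : DiffForm E M k).1 x₀ = fun _ => 0 := rfl
  rw [inChart_zero, extDeriv, fderiv_fun_const]
  exact map_zero (ContinuousAlternatingMap.alternatizeUncurryFinCLM ℝ E ℝ)

variable [FiniteDimensional ℝ E]

theorem extD_one_form_apply (α : DiffForm E M 1) (X Y : VField E M) (x : M) :
    (extD α).1 x ![X x, Y x] = (extD (interior Y α)).1 x ![X x]
      - (extD (interior X α)).1 x ![Y x] - α.1 x ![lieBracket X Y x] := by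
  obtain ⟨x₀, y, hy, rfl⟩ := exists_eq_extChartAt_symm (E := E) x
  have inChart_interior_eventuallyEq (Z : VField E M) :
      (fun z => inChart (interior Z α).1 x₀ z ![]) =ᶠ[nhds y]
        fun z => inChart α.1 x₀ z ![fieldInChart Z x₀ z] :=
    Filter.eventually_of_mem (target_mem_nhds hy) fun z hz => inChart_interior_apply Z α hz
  rw [two_form_apply_eq_inChart _ hy, one_form_apply_eq_inChart α hy, extD_zero_form_apply _ hy,
    extD_zero_form_apply _ hy, inChart_extD α hy]
  change extDeriv (inChart α.1 x₀) y ![fieldInChart X x₀ y, fieldInChart Y x₀ y] =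
    fderiv ℝ (fun z => inChart (interior Y α).1 x₀ z ![]) y (fieldInChart X x₀ y)
      - fderiv ℝ (fun z => inChart (interior X α).1 x₀ z ![]) y (fieldInChart Y x₀ y)
      - inChart α.1 x₀ y ![fieldInChart (lieBracket X Y) x₀ y]
  rw [fieldInChart_lieBracket X Y hy, (inChart_interior_eventuallyEq X).fderiv_eq,
    (inChart_interior_eventuallyEq Y).fderiv_eq,
    extDeriv_one_form_apply (differentiableAt_inChart α hy) (differentiableAt_fieldInChart X hy)
      (differentiableAt_fieldInChart Y hy)]

theorem fnDer_zero_form (K : EndTM E M) (L : VectorTwoForm E M) (β : DiffForm E M 0) :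
    fnDer K L β = iotaEnd K (extD β) := by
  have iotaEnd_zero_form : iotaEnd K β = 0 := rfl
  have iotaTwo_zero_form : iotaTwo L β = 0 := rfl
  rw [fnDer, lieDer, iotaEnd_zero_form, iotaTwo_zero_form, extD_zero]
  exact (add_zero (_ - _)).trans (sub_zero (iotaEnd K (extD β)))

theorem fnDer_zero_form_apply (K : EndTM E M) (L : VectorTwoForm E M) (β : DiffForm E M 0) (x : M)
    (v : TangentSpace 𝓘(ℝ, E) x) : (fnDer K L β).1 x ![v] = (extD β).1 x ![K x v] := by
  rw [fnDer_zero_form]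
  exact insertEnd_one_apply (E := E) (K x) ((extD β).1 x) v

theorem interior_iotaEnd (K : EndTM E M) (X : VField E M) (α : DiffForm E M 1) :
    interior X (iotaEnd K α) = interior (applyEnd K X) α := by
  ext x v
  obtain rfl := Subsingleton.elim v ![]
  exact insertEnd_one_apply (E := E) (K x) (α.1 x) (X x)

/-- The bracket `[X, Y]_K = [K X, Y] + [X, K Y] - K [X, Y]` deformed by the endomorphism `K`. -/
def deformedBracket (K : EndTM E M) (X Y : VField E M) : VField E M :=
  lieBracket (applyEnd K X) Y + lieBracket X (applyEnd K Y) - applyEnd K (lieBracket X Y)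

theorem apply_deformedBracket (K : EndTM E M) (X Y : VField E M) (x : M) :
    K x (deformedBracket K X Y x) =
      lieBracket (applyEnd K X) (applyEnd K Y) x - torsion K X Y x := by
  have map_deformedBracket : K x (deformedBracket K X Y x) =
      K x (lieBracket (applyEnd K X) Y x) + K x (lieBracket X (applyEnd K Y) x)
        - K x (K x (lieBracket X Y x)) :=
    ((K x).map_sub _ _).trans (congrArg (· - _) ((K x).map_add _ _))
  have torsion_apply : torsion K X Y x = lieBracket (applyEnd K X) (applyEnd K Y) x
      - K x (lieBracket (applyEnd K X) Y x) - K x (lieBracket X (applyEnd K Y) x)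
        + K x (K x (lieBracket X Y x)) := rfl
  rw [map_deformedBracket, torsion_apply]
  abel

theorem fnDer_one_form_apply (K : EndTM E M) (L : VectorTwoForm E M) (α : DiffForm E M 1)
    (X Y : VField E M) (x : M) :
    (fnDer K L α).1 x ![X x, Y x] = (fnDer K L (interior Y α)).1 x ![X x]
      - (fnDer K L (interior X α)).1 x ![Y x]
      - α.1 x ![deformedBracket K X Y x - L.toSection x (X x) (Y x)] := by
  have lieDer_add_iotaTwo_apply : (fnDer K L α).1 x ![X x, Y x] =
      (extD α).1 x ![applyEnd K X x, Y x] + (extD α).1 x ![X x, applyEnd K Y x]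
      - (extD (iotaEnd K α)).1 x ![X x, Y x] + α.1 x ![L.toSection x (X x) (Y x)] :=
    congrArg₂ (· + ·) (congrArg (· - _) (insertEnd_two_apply (E := E) (K x) _ _ _))
      (insertBilin_one_apply (E := E) (L.map_self x) (α.1 x) _ _)
  have map_sub_deformedBracket :
      α.1 x ![deformedBracket K X Y x - L.toSection x (X x) (Y x)] =
        α.1 x ![lieBracket (applyEnd K X) Y x] + α.1 x ![lieBracket X (applyEnd K Y) x]
        - α.1 x ![applyEnd K (lieBracket X Y) x] - α.1 x ![L.toSection x (X x) (Y x)] :=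
    (ContinuousAlternatingMap.map_vecCons_sub _ _ _ _).trans (congrArg (· - _)
      ((ContinuousAlternatingMap.map_vecCons_sub _ _ _ _).trans (congrArg (· - _)
        (ContinuousAlternatingMap.vecCons_add _ _ _ _))))
  have iotaEnd_apply : (iotaEnd K α).1 x ![lieBracket X Y x] =
      α.1 x ![applyEnd K (lieBracket X Y) x] :=
    insertEnd_one_apply (E := E) (K x) (α.1 x) _
  have fnDer_interior_apply (Z W : VField E M) : (fnDer K L (interior W α)).1 x ![Z x] =
      (extD (interior W α)).1 x ![applyEnd K Z x] :=
    fnDer_zero_form_apply K L _ x (Z x)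
  rw [lieDer_add_iotaTwo_apply, map_sub_deformedBracket, extD_one_form_apply α,
    extD_one_form_apply α, extD_one_form_apply (iotaEnd K α), interior_iotaEnd, interior_iotaEnd,
    iotaEnd_apply, fnDer_interior_apply, fnDer_interior_apply]
  ring

theorem fnDer_fnDer_zero_form_apply (K : EndTM E M) (L : VectorTwoForm E M) (β : DiffForm E M 0)
    (X Y : VField E M) (x : M) :
    (fnDer K L (fnDer K L β)).1 x ![X x, Y x] =
      (extD β).1 x ![K x (L.toSection x (X x) (Y x)) + torsion K X Y x] := by
  have fnDer_interior_apply (Z W : VField E M) :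
      (fnDer K L (interior W (fnDer K L β))).1 x ![Z x] =
        (extD (interior (applyEnd K W) (extD β))).1 x ![applyEnd K Z x] := by
    rw [fnDer_zero_form K L β, interior_iotaEnd]
    exact fnDer_zero_form_apply K L _ x (Z x)
  have extD_apply_lieBracket := extD_one_form_apply (extD β) (applyEnd K X) (applyEnd K Y) x
  have extD_extD_apply : (extD (extD β)).1 x ![applyEnd K X x, applyEnd K Y x] = 0 := by
    rw [extD_extD]
    rfl
  have map_map_sub : (extD β).1 x ![K x (deformedBracket K X Y x - L.toSection x (X x) (Y x))] =
      (extD β).1 x ![lieBracket (applyEnd K X) (applyEnd K Y) x]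
        - (extD β).1 x ![K x (L.toSection x (X x) (Y x)) + torsion K X Y x] := by
    rw [map_sub, apply_deformedBracket, sub_sub, add_comm (torsion K X Y x)]
    exact ContinuousAlternatingMap.map_vecCons_sub _ _ _ _
  rw [fnDer_one_form_apply, fnDer_interior_apply, fnDer_interior_apply, fnDer_zero_form_apply,
    map_map_sub]
  linarith

end Cartan

section Separation

variable {E : Type*} [NormedAddCommGroup E] [NormedSpace ℝ E] [FiniteDimensional ℝ E]
  {M : Type*} [TopologicalSpace M] [T2Space M] [ChartedSpace E M] [IsManifold 𝓘(ℝ, E) ∞ M]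

theorem exists_vField_apply_eq (x : M) (v : TangentSpace 𝓘(ℝ, E) x) :
    ∃ X : VField E M, X x = v := by
  obtain ⟨ψ⟩ : Nonempty (SmoothBumpFunction 𝓘(ℝ, E) x) := inferInstance
  let constantField : ∀ z : M, TangentSpace 𝓘(ℝ, E) z := fun z =>
    chartDInv (E := E) x (extChartAt 𝓘(ℝ, E) x z) (chartD (E := E) x (extChartAt 𝓘(ℝ, E) x x) v)
  have contMDiff_smul := ContMDiffOn.smul_section_of_tsupport (s := constantField) (n := ∞)
    ψ.contMDiff.contMDiffOn (chartAt E x).open_source ψ.tsupport_subset_chartAt_source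
    (contMDiffOn_chartDInv x _)
  have constantField_apply : constantField x = v :=
    chartDInv_chartD_apply (E := E) (mem_extChartAt_target x) v
  refine ⟨⟨_, contMDiff_smul⟩, ?_⟩
  change ψ x • constantField x = v
  rw [ψ.eq_one, one_smul, constantField_apply]

theorem exists_fieldInChart_eq {x₀ : M} {y : E} (hy : y ∈ (extChartAt 𝓘(ℝ, E) x₀).target)
    (u : E) : ∃ X : VField E M, fieldInChart X x₀ y = u := by
  obtain ⟨X, hX⟩ := exists_vField_apply_eq (E := E) ((extChartAt 𝓘(ℝ, E) x₀).symm y)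
    (chartDInv x₀ y u)
  exact ⟨X, (congrArg (chartD x₀ y) hX).trans (chartD_chartDInv_apply hy u)⟩

theorem exists_mfderiv_eq_comp_chartDAt (x : M) (l : E →L[ℝ] ℝ) :
    ∃ f : C^∞⟮𝓘(ℝ, E), M; ℝ⟯, mfderiv 𝓘(ℝ, E) 𝓘(ℝ, ℝ) f x = l ∘L chartDAt x x := by
  have : IsManifold 𝓘(ℝ, E) 1 M := .of_le (n := ∞) (by simp)
  obtain ⟨ψ⟩ : Nonempty (SmoothBumpFunction 𝓘(ℝ, E) x) := inferInstance
  have contMDiffOn_coordinate : ContMDiffOn 𝓘(ℝ, E) 𝓘(ℝ, ℝ) ∞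
      (fun z => l (extChartAt 𝓘(ℝ, E) x z)) (chartAt E x).source :=
    l.contMDiff.comp_contMDiffOn contMDiffOn_extChartAt
  have smul_eventuallyEq : (fun z => ψ z • l (extChartAt 𝓘(ℝ, E) x z)) =ᶠ[nhds x]
      l ∘ extChartAt 𝓘(ℝ, E) x :=
    ψ.eventuallyEq_one.mono fun z hz => by simp [hz]
  have mfderiv_coordinate := mfderiv_comp (I := 𝓘(ℝ, E)) (I' := 𝓘(ℝ, E)) (I'' := 𝓘(ℝ, ℝ)) (g := l)
    (f := extChartAt 𝓘(ℝ, E) x) x l.differentiableAt.mdifferentiableAt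
    (mdifferentiableAt_extChartAt (mem_chart_source E x))
  rw [mfderiv_eq_fderiv, l.fderiv] at mfderiv_coordinate
  exact ⟨⟨_, ψ.contMDiff_smul contMDiffOn_coordinate⟩,
    (smul_eventuallyEq.mfderiv_eq (I := 𝓘(ℝ, E)) (I' := 𝓘(ℝ, ℝ))).trans mfderiv_coordinate⟩

theorem eq_zero_of_forall_mfderiv_eq_zero {x : M} {v : TangentSpace 𝓘(ℝ, E) x}
    (h : ∀ f : C^∞⟮𝓘(ℝ, E), M; ℝ⟯, mfderiv 𝓘(ℝ, E) 𝓘(ℝ, ℝ) f x v = 0) : v = 0 := by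
  have chartDAt_eq_zero : chartDAt (E := E) x x v = 0 :=
    SeparatingDual.eq_zero_of_forall_dual_eq_zero (R := ℝ) fun l => by
      obtain ⟨f, hf⟩ := exists_mfderiv_eq_comp_chartDAt x l
      exact (congrArg (fun T : E →L[ℝ] ℝ => T v) hf).symm.trans (h f)
  have chartDAt_eq_chartD : chartDAt (E := E) x x = chartD x (extChartAt 𝓘(ℝ, E) x x) := by
    rw [chartDAt, chartD, extChartAt_to_inv]
  rw [chartDAt_eq_chartD] at chartDAt_eq_zero
  exact (chartDInv_chartD_apply (E := E) (mem_extChartAt_target x) v).symm.trans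
    ((congrArg (chartDInv x (extChartAt 𝓘(ℝ, E) x x)) chartDAt_eq_zero).trans (map_zero _))

theorem eq_of_forall_mfderiv_eq {x : M} {v w : TangentSpace 𝓘(ℝ, E) x}
    (h : ∀ f : C^∞⟮𝓘(ℝ, E), M; ℝ⟯, mfderiv 𝓘(ℝ, E) 𝓘(ℝ, ℝ) f x v =
      mfderiv 𝓘(ℝ, E) 𝓘(ℝ, ℝ) f x w) : v = w :=
  sub_eq_zero.1 (eq_zero_of_forall_mfderiv_eq_zero fun f => by rw [map_sub, h f, sub_self])

end Separation

section SquareZero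

theorem eq_neg_inverse_apply_iff {R V W : Type*} [Ring R] [AddCommGroup V] [TopologicalSpace V]
    [Module R V] [AddCommGroup W] [TopologicalSpace W] [Module R W] {f : V →L[R] W}
    (hf : f.IsInvertible) {v : V} {w : W} : v = -f.inverse w ↔ f v = -w := by
  rw [← hf.injective.eq_iff, map_neg, hf.self_apply_inverse]

variable {E : Type*} [NormedAddCommGroup E] [NormedSpace ℝ E]
  {M : Type*} [TopologicalSpace M] [ChartedSpace E M] [IsManifold 𝓘(ℝ, E) ∞ M]

theorem endInChart_bilinInChart_fieldInChart (K : EndTM E M) (L : VectorTwoForm E M)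
    (X Y : VField E M) {x₀ : M} {y : E} (hy : y ∈ (extChartAt 𝓘(ℝ, E) x₀).target) :
    endInChart K x₀ y (bilinInChart L x₀ y (fieldInChart X x₀ y) (fieldInChart Y x₀ y)) =
      chartD x₀ y (K ((extChartAt 𝓘(ℝ, E) x₀).symm y)
        (L.toSection ((extChartAt 𝓘(ℝ, E) x₀).symm y) (X ((extChartAt 𝓘(ℝ, E) x₀).symm y))
          (Y ((extChartAt 𝓘(ℝ, E) x₀).symm y)))) := by
  rw [bilinInChart_fieldInChart L X Y hy]
  exact endInChart_chartD_apply K hy _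

theorem compContinuousLinearMap_inChart {k : ℕ} (K : EndTM E M) (α : DiffForm E M k) {x₀ : M}
    {y : E} (hy : y ∈ (extChartAt 𝓘(ℝ, E) x₀).target) :
    inChart (fun x => (α.1 x).compContinuousLinearMap (K x)) x₀ y =
      (inChart α.1 x₀ y).compContinuousLinearMap (endInChart K x₀ y) := by
  ext v
  exact congrArg (α.1 ((extChartAt 𝓘(ℝ, E) x₀).symm y))
    (funext fun i => (chartDInv_chartD_apply hy _).symm)

variable [FiniteDimensional ℝ E]

/-- The pullback `K^* α = α (K ·, …, K ·)` of a form along an endomorphism `K` of `TM`. -/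
def pullbackEnd (K : EndTM E M) {k : ℕ} (α : DiffForm E M k) : DiffForm E M k :=
  ⟨fun x => (α.1 x).compContinuousLinearMap (K x), fun x₀ =>
    (contDiffOn_compContinuousLinearMap (contDiffOn_endInChart K x₀) (α.2 x₀)).congr fun _ hy =>
      compContinuousLinearMap_inChart K α hy⟩

theorem inChart_pullbackEnd {k : ℕ} (K : EndTM E M) (α : DiffForm E M k) {x₀ : M} {y : E}
    (hy : y ∈ (extChartAt 𝓘(ℝ, E) x₀).target) :
    inChart (pullbackEnd K α).1 x₀ y =
      (inChart α.1 x₀ y).compContinuousLinearMap (endInChart K x₀ y) :=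
  compContinuousLinearMap_inChart K α hy

/-- The inverse of an invertible endomorphism of `TM`. -/
def inverseEnd (K : EndTM E M) (hK : ∀ x : M, (K x).IsInvertible) : EndTM E M :=
  ⟨fun x => (K x).inverse, fun x₀ => by
    have : CompleteSpace E := FiniteDimensional.complete ℝ E
    rw [contMDiffAt_hom_bundle]
    refine ⟨contMDiffAt_id, ?_⟩
    have contMDiffAt_inCoordinates := ((contMDiffAt_hom_bundle _).1 (K.contMDiff x₀)).2
    have mem_baseSet := FiberBundle.mem_baseSet_trivializationAt' (F := E)
      (E := (TangentSpace 𝓘(ℝ, E) : M → Type _)) x₀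
    have isInvertible_inCoordinates :
        (ContinuousLinearMap.inCoordinates E (TangentSpace 𝓘(ℝ, E) (M := M)) E
          (TangentSpace 𝓘(ℝ, E) (M := M)) x₀ x₀ x₀ x₀ (K x₀)).IsInvertible := by
      rw [ContinuousLinearMap.inCoordinates_eq mem_baseSet mem_baseSet]
      exact ContinuousLinearMap.isInvertible_equiv.comp
        ((hK x₀).comp ContinuousLinearMap.isInvertible_equiv)
    refine ((isInvertible_inCoordinates.contDiffAt_map_inverse (n := ∞)).contMDiffAt.comp x₀
      contMDiffAt_inCoordinates).congr_of_eventuallyEq ?_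
    filter_upwards [(trivializationAt E (TangentSpace 𝓘(ℝ, E) : M → Type _)
      x₀).open_baseSet.mem_nhds mem_baseSet] with x hx
    simp only [Function.comp_apply]
    rw [ContinuousLinearMap.inCoordinates_eq hx hx, ContinuousLinearMap.inCoordinates_eq hx hx,
      ContinuousLinearMap.inverse_equiv_comp, ContinuousLinearMap.inverse_comp_equiv]
    rfl⟩

theorem pullbackEnd_pullbackEnd_inverseEnd {K : EndTM E M} (hK : ∀ x : M, (K x).IsInvertible)
    {k : ℕ} (α : DiffForm E M k) : pullbackEnd K (pullbackEnd (inverseEnd K hK) α) = α := by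
  ext x v
  exact congrArg (α.1 x) (funext fun i => (hK x).inverse_apply_self (v i))

variable [T2Space M]

theorem fnDer_pullbackEnd {K : EndTM E M} {L : VectorTwoForm E M}
    (hKL : ∀ (X Y : VField E M) (x : M),
      K x (L.toSection x (X x) (Y x)) = -torsion K X Y x)
    {k : ℕ} (α : DiffForm E M k) :
    fnDer K L (pullbackEnd K α) = pullbackEnd K (extD α) := by
  refine eq_of_inChart_eq fun x₀ y hy => ?_
  have inChart_pullbackEnd_eventuallyEq : inChart (pullbackEnd K α).1 x₀ =ᶠ[nhds y]
      fun z => (inChart α.1 x₀ z).compContinuousLinearMap (endInChart K x₀ z) :=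
    Filter.eventually_of_mem (target_mem_nhds hy) fun z hz => inChart_pullbackEnd K α hz
  have apply_bilinInChart (u w : E) : endInChart K x₀ y (bilinInChart L x₀ y u w) =
      -localTorsion (endInChart K x₀) y u w := by
    obtain ⟨X, rfl⟩ := exists_fieldInChart_eq hy u
    obtain ⟨Y, rfl⟩ := exists_fieldInChart_eq hy w
    rw [endInChart_bilinInChart_fieldInChart K L X Y hy, ← fieldInChart_torsion K X Y hy, hKL]
    exact map_neg (chartD x₀ y) _
  rw [inChart_fnDer K L _ hy, localFnDer_congr_of_eventuallyEq _ _ inChart_pullbackEnd_eventuallyEq,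
    localFnDer_compContinuousLinearMap_of_eq_neg_torsion (differentiableAt_endInChart K hy)
      (differentiableAt_inChart α hy) apply_bilinInChart,
    inChart_pullbackEnd K _ hy, inChart_extD α hy]

theorem fnDer_fnDer_eq_zero_of_apply_eq_neg_torsion {K : EndTM E M}
    (hK : ∀ x : M, (K x).IsInvertible) {L : VectorTwoForm E M}
    (hKL : ∀ (X Y : VField E M) (x : M),
      K x (L.toSection x (X x) (Y x)) = -torsion K X Y x)
    {k : ℕ} (α : DiffForm E M k) : fnDer K L (fnDer K L α) = 0 := by
  rw [← pullbackEnd_pullbackEnd_inverseEnd hK α, fnDer_pullbackEnd hKL, fnDer_pullbackEnd hKL,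
    extD_extD]
  rfl

theorem apply_eq_neg_torsion_of_fnDer_fnDer_eq_zero {K : EndTM E M} {L : VectorTwoForm E M}
    (hD : ∀ β : DiffForm E M 0, fnDer K L (fnDer K L β) = 0) (X Y : VField E M) (x : M) :
    K x (L.toSection x (X x) (Y x)) = -torsion K X Y x := by
  rw [eq_neg_iff_add_eq_zero]
  refine eq_zero_of_forall_mfderiv_eq_zero fun f => ?_
  rw [← extD_ofFun_apply, ← fnDer_fnDer_zero_form_apply, hD]
  rfl

theorem forall_fnDer_fnDer_eq_zero_iff {K : EndTM E M} (hK : ∀ x : M, (K x).IsInvertible)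
    (L : VectorTwoForm E M) :
    (∀ (k : ℕ) (α : DiffForm E M k), fnDer K L (fnDer K L α) = 0) ↔
      ∀ (X Y : VField E M) (x : M),
        L.toSection x (X x) (Y x) = -(K x).inverse (torsion K X Y x) := by
  simp only [eq_neg_inverse_apply_iff (hK _)]
  exact ⟨fun hD => apply_eq_neg_torsion_of_fnDer_fnDer_eq_zero (hD 0),
    fun hKL _ => fnDer_fnDer_eq_zero_of_apply_eq_neg_torsion hK hKL⟩

end SquareZero

section Algebroid

variable {E : Type*} [NormedAddCommGroup E] [NormedSpace ℝ E]
  {M : Type*} [TopologicalSpace M] [ChartedSpace E M] [IsManifold 𝓘(ℝ, E) ∞ M]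

theorem applyEnd_mulField (K : EndTM E M) (f : C^∞⟮𝓘(ℝ, E), M; ℝ⟯) (X : VField E M) :
    applyEnd K (mulField f X) = mulField f (applyEnd K X) := by
  ext x
  exact (K x).map_smul (f x) (X x)

variable [FiniteDimensional ℝ E]

theorem applyEnd_inverseEnd {K : EndTM E M} (hK : ∀ x : M, (K x).IsInvertible) (X : VField E M) :
    applyEnd K (applyEnd (inverseEnd K hK) X) = X := by
  ext x
  exact (hK x).self_apply_inverse (X x)

/-- The action of an endomorphism of `TM` on vector fields, as a linear map. -/
def applyEndLinear (K : EndTM E M) : VField E M →ₗ[ℝ] VField E M where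
  toFun := applyEnd K
  map_add' X Y := by
    ext x
    exact (K x).map_add (X x) (Y x)
  map_smul' c X := by
    ext x
    exact (K x).map_smul c (X x)

/-- The Lie algebroid structure on `TM` with anchor `K` and bracket `K⁻¹ [K X, K Y]`: the trivial
one transported along `K`. -/
def conjugateAlgebroid (K : EndTM E M) (hK : ∀ x : M, (K x).IsInvertible) :
    LieAlgebroidTM E M where
  anchor := K
  bracket := ((lieBracketBilin E M).compl₁₂ (applyEndLinear K) (applyEndLinear K)).compr₂
    (applyEndLinear (inverseEnd K hK))
  bracket_self X := by
    have h := congrArg (applyEndLinear (inverseEnd K hK))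
      ((trivialAlgebroid E M).bracket_self (applyEnd K X))
    rw [map_zero] at h
    exact h
  jacobi X Y Z := by
    have h := congrArg (applyEndLinear (inverseEnd K hK))
      ((trivialAlgebroid E M).jacobi (applyEnd K X) (applyEnd K Y) (applyEnd K Z))
    rw [map_add] at h
    change applyEnd (inverseEnd K hK) (lieBracket (applyEnd K X) (applyEnd K
        (applyEnd (inverseEnd K hK) (lieBracket (applyEnd K Y) (applyEnd K Z))))) =
      applyEnd (inverseEnd K hK) (lieBracket (applyEnd K
        (applyEnd (inverseEnd K hK) (lieBracket (applyEnd K X) (applyEnd K Y)))) (applyEnd K Z)) +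
      applyEnd (inverseEnd K hK) (lieBracket (applyEnd K Y) (applyEnd K
        (applyEnd (inverseEnd K hK) (lieBracket (applyEnd K X) (applyEnd K Z)))))
    rw [applyEnd_inverseEnd, applyEnd_inverseEnd, applyEnd_inverseEnd]
    exact h
  leibniz X Y f x := by
    have inverse_apply_applyEnd : (K x).inverse (applyEnd K Y x) = Y x :=
      (hK x).inverse_apply_self (Y x)
    have h := congrArg (K x).inverse
      ((trivialAlgebroid E M).leibniz (applyEnd K X) (applyEnd K Y) f x)
    rw [map_add, map_smul, map_smul, ← applyEnd_mulField, inverse_apply_applyEnd] at h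
    exact h

theorem conjugateAlgebroid_bracket_apply {K : EndTM E M} (hK : ∀ x : M, (K x).IsInvertible)
    (X Y : VField E M) (x : M) : (conjugateAlgebroid K hK).bracket X Y x =
      deformedBracket K X Y x + (K x).inverse (torsion K X Y x) := by
  have bracket_apply : (conjugateAlgebroid K hK).bracket X Y x =
      (K x).inverse (lieBracket (applyEnd K X) (applyEnd K Y) x) := rfl
  rw [bracket_apply, ← (hK x).injective.eq_iff, map_add, (hK x).self_apply_inverse,
    (hK x).self_apply_inverse, apply_deformedBracket, sub_add_cancel]

theorem isDeterminedBy_conjugateAlgebroid {K : EndTM E M} (hK : ∀ x : M, (K x).IsInvertible)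
    {L : VectorTwoForm E M}
    (hL : ∀ (X Y : VField E M) (x : M),
      L.toSection x (X x) (Y x) = -(K x).inverse (torsion K X Y x)) :
    (conjugateAlgebroid K hK).IsDeterminedBy (fnDer K L) where
  anchor_eq X f x := by
    rw [fnDer_zero_form_apply, extD_ofFun_apply]
    rfl
  bracket_eq X Y α x := by
    rw [fnDer_one_form_apply, sub_sub_cancel, hL, sub_neg_eq_add,
      conjugateAlgebroid_bracket_apply hK]

/-- The anchor `K`, as an isomorphism onto the trivial Lie algebroid. -/
def conjugateAlgebroidIso (K : EndTM E M) (hK : ∀ x : M, (K x).IsInvertible) :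
    (conjugateAlgebroid K hK).Iso (trivialAlgebroid E M) where
  toEnd := K
  isInvertible := hK
  anchor_comp _ _ := rfl
  map_bracket X Y := applyEnd_inverseEnd hK (lieBracket (applyEnd K X) (applyEnd K Y))

theorem LieAlgebroidTM.IsDeterminedBy.unique [T2Space M] {𝓐 𝓑 : LieAlgebroidTM E M}
    {D : ∀ {k : ℕ}, DiffForm E M k → DiffForm E M (k + 1)} (hA : 𝓐.IsDeterminedBy D)
    (hB : 𝓑.IsDeterminedBy D) : 𝓐 = 𝓑 := by
  refine LieAlgebroidTM.ext ?_ ?_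
  · ext x v
    obtain ⟨X, rfl⟩ := exists_vField_apply_eq (E := E) x v
    exact eq_of_forall_mfderiv_eq fun f => (hA.anchor_eq X f x).trans (hB.anchor_eq X f x).symm
  · ext X Y x
    refine eq_of_forall_mfderiv_eq fun f => ?_
    rw [← extD_ofFun_apply, ← extD_ofFun_apply]
    exact (hA.bracket_eq X Y _ x).trans (hB.bracket_eq X Y _ x).symm

end Algebroid

end TangentAlgebroid

end

theorem mainTheorem7 {E : Type*} [NormedAddCommGroup E] [NormedSpace ℝ E] [FiniteDimensional ℝ E]
    {M : Type*} [TopologicalSpace M] [T2Space M] [ChartedSpace E M] [IsManifold 𝓘(ℝ, E) ∞ M]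
    (K : TangentAlgebroid.EndTM E M) (hK : ∀ x : M, (K x).IsInvertible)
    (L : TangentAlgebroid.VectorTwoForm E M) :
    ((∀ (k : ℕ) (α : TangentAlgebroid.DiffForm E M k),
        TangentAlgebroid.fnDer K L (TangentAlgebroid.fnDer K L α) = 0) ↔
      ∀ (X Y : TangentAlgebroid.VField E M) (x : M),
        L.toSection x (X x) (Y x) = -(K x).inverse (TangentAlgebroid.torsion K X Y x)) ∧
    ((∀ (k : ℕ) (α : TangentAlgebroid.DiffForm E M k),
        TangentAlgebroid.fnDer K L (TangentAlgebroid.fnDer K L α) = 0) →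
      ∃ 𝓐 : TangentAlgebroid.LieAlgebroidTM E M,
        𝓐.IsDeterminedBy (TangentAlgebroid.fnDer K L) ∧
        (∀ 𝓑 : TangentAlgebroid.LieAlgebroidTM E M,
          𝓑.IsDeterminedBy (TangentAlgebroid.fnDer K L) → 𝓑 = 𝓐) ∧
        𝓐.anchor = K ∧
        (∀ (X Y : TangentAlgebroid.VField E M) (x : M),
          𝓐.bracket X Y x = (K x).inverse (TangentAlgebroid.lieBracket
            (TangentAlgebroid.applyEnd K X) (TangentAlgebroid.applyEnd K Y) x)) ∧
        Nonempty (𝓐.Iso (TangentAlgebroid.trivialAlgebroid E M))) := by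
  have sq_zero_iff := TangentAlgebroid.forall_fnDer_fnDer_eq_zero_iff hK L
  refine ⟨sq_zero_iff, fun hD => ?_⟩
  have isDetermined := TangentAlgebroid.isDeterminedBy_conjugateAlgebroid hK (sq_zero_iff.1 hD)
  exact ⟨TangentAlgebroid.conjugateAlgebroid K hK, isDetermined,
    fun 𝓑 hB => hB.unique isDetermined, rfl, fun _ _ _ => rfl,
    ⟨TangentAlgebroid.conjugateAlgebroidIso K hK⟩⟩
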